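/- **Setting.** There are $m$ contents, $m$ fixed; each user requests content $k$ with probability $\alpha_k>0$, $\sum_k\alpha_k=1$, the $\alpha_k$ not depending on the number $n$ of nodes. In the network with $n$ nodes each node's cache holds content $k$ with probability $\rho^{(k)}(n)\in[0,1]$, independently of the other caches; a server holds every content. The $\rho^{(k)}(n)$ do not approach $1$: there is $q<1$ with $\min_k\rho^{(k)}(n)\le q$ for all large $n$. All stations share a wireless channel of bandwidth $W(n)=\Theta(1)$, $W(n)>0$, with common transmission range $r$, under the protocol model with a fixed guard parameter $\Delta>0$: a set of links, each of length at most $r$, may be active simultaneously if the transmitter of each link is at distance at least $(1+\Delta)r$ from the receiver of every other link. Active links carry $W(n)$ bits per second, and admissible sets of links may be time-shared. A user whose cache lacks the requested content downloads it hop by hop along the path determined by the discovery mechanism. A common rate $\gamma\ge 0$ is achievable if some time sharing gives each link at least the mean traffic it carries (mean over requests and cache contents) when every user downloads at rate $\gamma$; $\gamma_{\max}$ is the largest achievable rate. **Scenario i.** The $n$ nodes form a $\sqrt n\times\sqrt n$ square grid whose spacing equals the transmission range, and the server is attached to the middle node. Each user follows a fixed shortest path to the server and downloads along it from the first node on the path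 that has the content (path-wise discovery). **Scenario ii.** The same grid; each user downloads along a shortest path from a nearest copy, the server included (expanding-ring search). **Scenario iii.** The $n$ nodes are independent and uniform in the unit square, and the server is at its centre. The range satisfies $0<r(n)\le 1$ and, for all large $n$, $r(n)\ge K\sqrt{\log n/n}$. The square is divided into $M\times M$ equal cells, $M=\lceil 1/(\kappa r(n))\rceil$, where $0<\kappa\le 1/\sqrt5$ and $\kappa K>1$ are constants (so stations in adjacent cells are in range, and with high probability no cell is empty). A request follows a fixed shortest path of cells to the server's cell: the user asks the stations of its own cell and of the next cell of the path; if none of them has the content, one relay node in that next cell asks the cell after it, and so on. The content is downloaded back through the relays from a station having it in the first successful step. **Theorem.** As $n\to\infty$ (through perfect squares in Scenarios i and ii), whatever the choices of paths, of relays, and among several available copies, the maximum achievable throughput $\gamma_{\max}$ exists and is of order - Scenario i: $\Theta\big(\max\big(\tfrac1n,\ \min_k(\rho^{(k)}(n))^2\big)\big)$; - Scenario ii: $\Theta\big(\max\big(\tfrac1n,\ \min_k\rho^{(k)}(n)\big)\big)$; - Scenario iii: $\Theta\big(\max\big[\tfrac1n,\ \min\big(\tfrac1{n r(n)^2},\ \min_k(\rho^{(k)}(n))^2\,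 n r(n)^2\big)\big]\big)$, with probability tending to $1$ over the positions of the nodes. The constants in $\Theta$ do not depend on $n$, on those choices, or on the positions of the nodes. -/

import Mathlib

open Filter Asymptotics Topology
open scoped BigOperators

noncomputable section

namespace CacheNet

/-- The Euclidean plane. -/
abbrev Plane : Type := EuclideanSpace ℝ (Fin 2)

/-! ### The wireless channel: range, protocol interference model, time sharing -/

/-- Two distinct stations are neighbours when they are within transmission range `r`. -/
def commGraph {T : Type} (pos : T → Plane) (r : ℝ) : SimpleGraph T where
  Adj a b := a ≠ b ∧ dist (pos a) (pos b) ≤ r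
  symm := ⟨fun _ _ h => ⟨h.1.symm, by rw [dist_comm]; exact h.2⟩⟩
  loopless := ⟨fun _ h => h.1 rfl⟩

/-- Protocol model with guard zone `Δ`.  A link `(a, b)` means that `a` transmits to `b`.
A set `A` of links can be active simultaneously when every link is within range and, for any two
different active links, the transmitter of the one is at distance at least `(1 + Δ) r` from the
receiver of the other.  (So a station never receives while it transmits, never receives from two
stations at once, and never transmits to two stations at once.) -/
def Concurrent {T : Type} (pos : T → Plane) (r Δ : ℝ) (A : Finset (T × T)) : Prop :=
  (∀ e ∈ A, (commGraph pos r).Adj e.1 e.2) ∧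
    ∀ e ∈ A, ∀ e' ∈ A, e ≠ e' → (1 + Δ) * r ≤ dist (pos e'.1) (pos e.2)

/-- The channel, of bandwidth `W`, can carry the traffic `load a b` (bits per second from `a` to
`b`, for all pairs): there is a time sharing between simultaneously admissible sets of links, the
set `A` being active during the fraction `τ A` of the time, that gives each link enough rate. -/
def Supportable {T : Type} [Fintype T] [DecidableEq T] (pos : T → Plane) (r Δ W : ℝ)
    (load : T → T → ℝ) : Prop :=
  ∃ τ : Finset (T × T) → ℝ,
    (∀ A, 0 ≤ τ A) ∧ (∀ A, τ A ≠ 0 → Concurrent pos r Δ A) ∧ ∑ A, τ A ≤ 1 ∧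
      ∀ a b, load a b ≤ W * ∑ A with (a, b) ∈ A, τ A

/-! ### Cached contents, deliveries, throughput capacity -/

/-- The probability that the set of caches which hold a content is exactly `S`, when every cache
holds it with probability `p`, independently of the others. -/
def placementProb {U : Type} [Fintype U] (p : ℝ) (S : Finset U) : ℝ :=
  p ^ S.card * (1 - p) ^ (Fintype.card U - S.card)

/-- The outcome of content discovery and the path of the download.  `D v S` is the list of
stations from the requesting user `v` (first entry) to the station that serves the request (last
entry) when `S` is the set of users whose caches hold the content.  The data travel along this
list backwards, one hop after the other. -/
abbrev Delivery (U T : Type) : Type := U → Finset U → List T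

/-- The mean traffic from station `a` to station `b` when each user downloads at rate `γ`, the
content `k` being requested with probability `α k` and present in each cache with
probability `ρ k`. -/
def linkLoad {U T : Type} [Fintype U] [DecidableEq T] {m : ℕ} (α ρ : Fin m → ℝ)
    (D : Delivery U T) (γ : ℝ) (a b : T) : ℝ :=
  γ * ∑ v : U, ∑ k : Fin m, α k *
    ∑ S : Finset U, placementProb (ρ k) S * (if [b, a] <:+: D v S then 1 else 0)

/-- The common download rates that all users can achieve, on average. -/
def achievableRates {U T : Type} [Fintype U] [Fintype T] [DecidableEq T] {m : ℕ}
    (pos : T → Plane) (r Δ W : ℝ) (α ρ : Fin m → ℝ) (D : Delivery U T) : Set ℝ :=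
  {γ | 0 ≤ γ ∧ Supportable pos r Δ W (linkLoad α ρ D γ)}

/-- The throughput capacity (the maximum achievable common download rate) exists and lies between
`lo` and `hi`. -/
def CapacityBetween {U T : Type} [Fintype U] [Fintype T] [DecidableEq T] {m : ℕ}
    (pos : T → Plane) (r Δ W : ℝ) (α ρ : Fin m → ℝ) (D : Delivery U T) (lo hi : ℝ) : Prop :=
  ∃ γ, IsGreatest (achievableRates pos r Δ W α ρ D) γ ∧ lo ≤ γ ∧ γ ≤ hi

/-! ### The grid network

The nodes form a square grid with `N + 1` nodes on each side, so that there are `(N + 1) ^ 2` of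
them, with spacing `1` and transmission range `1`. -/

/-- The nodes of the grid. -/
abbrev GridNode (N : ℕ) : Type := Fin (N + 1) × Fin (N + 1)

/-- The position of a node of the grid. -/
def gridPos (N : ℕ) (v : GridNode N) : Plane := !₂[((v.1 : ℕ) : ℝ), ((v.2 : ℕ) : ℝ)]

/-- The grid as a graph. -/
abbrev gridGraph (N : ℕ) : SimpleGraph (GridNode N) := commGraph (gridPos N) 1

/-- The node in the middle of the grid, to which the server is attached. -/
def gridServer (N : ℕ) : GridNode N :=
  (⟨N / 2, by omega⟩, ⟨N / 2, by omega⟩)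

/-- The initial part of a list up to and including its first entry in `H`. -/
def uptoFirst {V : Type} [DecidableEq V] (H : Finset V) : List V → List V
  | [] => []
  | v :: l => if v ∈ H then [v] else v :: uptoFirst H l

/-- Path-wise discovery: each user has a fixed shortest path to the server, and downloads along
this path from the first node on it (possibly itself) that has the content. -/
def IsGridPathwise (N : ℕ) (D : Delivery (GridNode N) (GridNode N)) : Prop :=
  ∃ route : ∀ v, (gridGraph N).Walk v (gridServer N),
    (∀ v, (route v).length = (gridGraph N).dist v (gridServer N)) ∧
      ∀ v S, D v S = uptoFirst (insert (gridServer N) S) (route v).support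

/-- Expanding-ring search: each user downloads, along a shortest path, from a nearest copy of
the content (ties being broken arbitrarily), the server being one of the copies. -/
def IsGridRingSearch (N : ℕ) (D : Delivery (GridNode N) (GridNode N)) : Prop :=
  ∀ v S, ∃ x ∈ insert (gridServer N) S,
    (∀ y ∈ insert (gridServer N) S, (gridGraph N).dist v x ≤ (gridGraph N).dist v y) ∧
      ∃ p : (gridGraph N).Walk v x,
        p.length = (gridGraph N).dist v x ∧ D v S = p.support

/-! ### The random network

`n` nodes at independent uniform points of the unit square; the law of their positions is the
product measure `volume` on `Fin n → UnitSquare`.  The stations are the nodes `some v` and the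
server `none`. -/

/-- The unit square. -/
abbrev UnitSquare : Type := unitInterval × unitInterval

/-- A point of the unit square as a point of the plane. -/
def squarePos (p : UnitSquare) : Plane := !₂[(p.1 : ℝ), (p.2 : ℝ)]

/-- The position of a station; the server is in the middle of the square. -/
def stationPos {n : ℕ} (x : Fin n → UnitSquare) : Option (Fin n) → Plane
  | some v => squarePos (x v)
  | none => !₂[1 / 2, 1 / 2]

/-- The number of cells on each side of the square, for cells of side about `κ r` (the largest
side at most `κ r` that divides `1`). -/
def cellsPerSide (κ r : ℝ) : ℕ := ⌈1 / (κ * r)⌉₊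

/-- The cell that contains a point of the unit square, the cells forming an `M × M` array. -/
def cellOf (M : ℕ) (p : Plane) : ℤ × ℤ :=
  (min ⌊M * p 0⌋ (M - 1), min ⌊M * p 1⌋ (M - 1))

/-- Two cells are adjacent when they have a common side. -/
def cellGraph : SimpleGraph (ℤ × ℤ) where
  Adj c d := |c.1 - d.1| + |c.2 - d.2| = 1
  symm := ⟨fun c d h => by rw [abs_sub_comm d.1, abs_sub_comm d.2]; exact h⟩
  loopless := ⟨fun c h => by simp at h⟩

/-- Path-wise discovery through cells.  Each user `v` has a fixed shortest path of cells to the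
cell of the server, and in the `j`-th cell of this path a fixed node `relay v j` that forwards the
requests of `v`.  A user that holds the content is served locally.  Otherwise its request is seen
first by the stations in its own cell and in the next cell; if none of these has the content, the
relay in that next cell forwards the request to the cell after it, and so on.  The user
downloads through the relays from a station (arbitrary in case of several) that has the content
in the cells of the first successful step. -/
def IsCellPathwise {n : ℕ} (M : ℕ) (x : Fin n → UnitSquare)
    (D : Delivery (Fin n) (Option (Fin n))) : Prop :=
  let cell : Option (Fin n) → ℤ × ℤ := fun a => cellOf M (stationPos x a)
  ∃ (path : ∀ v : Fin n, cellGraph.Walk (cell (some v)) (cell none)) (relay : Fin n → ℕ → Fin n),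
    (∀ v, (path v).length = cellGraph.dist (cell (some v)) (cell none)) ∧
    (∀ v j, 1 ≤ j → j < (path v).length → cell (some (relay v j)) = (path v).getVert j) ∧
    ∀ (v : Fin n) (S : Finset (Fin n)),
      let has : Option (Fin n) → Prop := fun a => a = none ∨ ∃ u ∈ S, a = some u
      let asked : ℕ → Option (Fin n) → Prop := fun j a =>
        cell a = (path v).getVert j ∨ (j = 1 ∧ cell a = cell (some v))
      (v ∈ S → D v S = [some v]) ∧
      (v ∉ S → ∃ J, 1 ≤ J ∧ (∀ j, 1 ≤ j → j < J → ∀ a, has a → ¬ asked j a) ∧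
        ∃ a, has a ∧ asked J a ∧
          D v S = some v :: (List.range' 1 (J - 1)).map (fun j => some (relay v j)) ++ [a])

end CacheNet

end

open CacheNet

/-!
The capacity of a caching network is computed up to constants by comparing the traffic around
bottlenecks with what the channel can carry there.

*Reduction to loads.*  The achievable rates form a closed interval (`capacityBetween_of_bounds`), so
it suffices to show that a rate of the right order is achievable and that no achievable rate is
larger than a multiple of it.

*Achievability.*  Cells whose coordinates agree modulo a constant `Q` do not interfere.  Drawing one
link per cell at random in proportion to its load, independently for the cells of one residue class,
gives a time sharing that supports any traffic with load at most `W / Q ^ 2` out of each cell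
(`supportable_of_cells`, `mem_achievableRates_of_cells`).  The load of a cell is a sum, over the users
at distance `d` from it, of the probability that the content is missing in all caches which are
searched before.  The number of these caches is of order `d` for path-wise discovery on the grid,
`d ^ 2` for expanding-ring search, and `d μ` for path-wise discovery through cells that hold about `μ`
users each.  As there are of order `d` nodes or cells at distance `d`, summation over taxicab spheres
(`sum_taxi_le`) gives loads of order `1 / ρ ^ 2`, `1 / ρ` and `μ + 1 / (ρ ^ 2 μ)`.  The number of
users is always a bound too.

*Converse.*  The links that leave the server exclude each other, so the users that depend on the
server share the rate `W` (`rate_mul_le`).  The probability that a content with parameter `p` is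
missing in `t` caches is bounded below as long as `p t` is bounded and `p` stays away from `1`
(`exp_le_eventProb`), so these are all the users in a box around the server whose side is of order
`1 / p`, `1 / √p` and `1 / (p μ)` respectively, or all users if that exceeds the network
(`grid_rate_mul_le`, `cell_rate_le_of_server`).  In the unit square there is a second bottleneck: only
of the order of `1 / r ^ 2` links can be active at once, and every user needs at least one hop with
positive probability (`cell_rate_le_of_reuse`).

*Random positions.*  By Chernoff and union bounds, with high probability all cells hold between `δ μ`
and `4 μ` users, where `μ = n / M ^ 2` is the mean (`exists_regularOccupancy`).  The lower bound needs
`κ K > 1`, which makes `μ ≥ κ K log n` for large `n`; a small `δ` brings the exponent of the Chernoff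
bound close enough to `μ` to beat the number of cells.
-/

namespace CacheNet

/-! ### Random placements of a content -/

section Placement

variable {U : Type} [Fintype U]

theorem placementProb_nonneg {p : ℝ} (h0 : 0 ≤ p) (h1 : p ≤ 1) (S : Finset U) :
    0 ≤ placementProb p S :=
  mul_nonneg (pow_nonneg h0 _) (pow_nonneg (by linarith) _)

theorem placementProb_eq_prod [DecidableEq U] (p : ℝ) (S : Finset U) :
    placementProb p S = (∏ _u ∈ S, p) * ∏ _u ∈ Finset.univ \ S, (1 - p) := by
  simp [placementProb, Finset.card_sdiff, Finset.card_univ]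

open Classical in
/-- The probability that the random set of caches holding a content, each with probability `p`
independently of the others, satisfies `P`. -/
noncomputable def eventProb (p : ℝ) (P : Finset U → Prop) : ℝ :=
  ∑ S : Finset U, placementProb p S * (if P S then 1 else 0)

theorem eventProb_mono {p : ℝ} (h0 : 0 ≤ p) (h1 : p ≤ 1) {P P' : Finset U → Prop}
    (h : ∀ S, P S → P' S) : eventProb p P ≤ eventProb p P' := by
  classical
  refine Finset.sum_le_sum fun S _ => mul_le_mul_of_nonneg_left ?_ (placementProb_nonneg h0 h1 S)
  by_cases hS : P S
  · simp [hS, h S hS]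
  · simp only [hS, if_false]; split_ifs <;> norm_num

/-- No cache of a given set `T` of users holds the content with probability `(1 - p) ^ |T|`. -/
theorem eventProb_disjoint (p : ℝ) (T : Finset U) :
    eventProb p (fun S => Disjoint S T) = (1 - p) ^ T.card := by
  classical
  have h := Finset.prod_add (fun u : U => if u ∈ T then 0 else p) (fun _ => 1 - p) Finset.univ
  have hL : ∏ u : U, ((if u ∈ T then 0 else p) + (1 - p)) = (1 - p) ^ T.card := by
    have : ∀ u : U, ((if u ∈ T then 0 else p) + (1 - p)) = if u ∈ T then 1 - p else 1 := by
      intro u; split_ifs <;> ring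
    simp only [this, Finset.prod_ite_mem, Finset.univ_inter, Finset.prod_const]
  rw [← hL, h, eventProb, Finset.powerset_univ]
  refine Finset.sum_congr rfl fun S _ => ?_
  rw [placementProb_eq_prod, mul_right_comm]
  congr 1
  by_cases hd : Disjoint S T
  · rw [if_pos hd, mul_one]
    exact Finset.prod_congr rfl fun u hu => (if_neg (Finset.disjoint_left.1 hd hu)).symm
  · rw [if_neg hd, mul_zero]
    obtain ⟨u, hu, hu'⟩ := Finset.not_disjoint_iff.1 hd
    exact (Finset.prod_eq_zero hu (by simp [hu'])).symm

theorem eventProb_le_one {p : ℝ} (h0 : 0 ≤ p) (h1 : p ≤ 1) (P : Finset U → Prop) :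
    eventProb p P ≤ 1 := by
  have := eventProb_disjoint (U := U) p ∅
  rw [Finset.card_empty, pow_zero] at this
  rw [← this]
  exact eventProb_mono h0 h1 fun S _ => Finset.disjoint_empty_right S

theorem one_sub_pow_le_exp {p : ℝ} (h1 : p ≤ 1) (t : ℕ) : (1 - p) ^ t ≤ Real.exp (-(p * t)) := by
  calc (1 - p) ^ t ≤ Real.exp (-p) ^ t :=
        pow_le_pow_left₀ (by linarith) (Real.one_sub_le_exp_neg p) t
    _ = Real.exp (-(p * t)) := by rw [← Real.exp_nat_mul]; congr 1; ring

/-- If the event forces the caches of `T` to lack the content, it is exponentially unlikely. -/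
theorem eventProb_le_exp {p : ℝ} (h0 : 0 ≤ p) (h1 : p ≤ 1) {P : Finset U → Prop}
    (T : Finset U) (h : ∀ S, P S → Disjoint S T) :
    eventProb p P ≤ Real.exp (-(p * T.card)) :=
  (eventProb_mono h0 h1 h).trans ((eventProb_disjoint p T).trans_le (one_sub_pow_le_exp h1 _))

/-- If the event only needs the caches of `T` to lack the content, it has a probability bounded
below in terms of `p * |T|`, as long as `p` stays away from `1`. -/
theorem exp_le_eventProb {p q : ℝ} (h0 : 0 ≤ p) (hq : p ≤ q) (hq1 : q < 1) {P : Finset U → Prop}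
    (T : Finset U) (h : ∀ S, Disjoint S T → P S) {B : ℝ} (hB : p * T.card ≤ B) :
    Real.exp (-(B / (1 - q))) ≤ eventProb p P := by
  have h1 : 0 < 1 - p := by linarith
  refine le_trans ?_ ((eventProb_disjoint p T).symm.trans_le
    (eventProb_mono h0 (by linarith) h))
  -- `1 - p ≥ exp (-p / (1 - p))`, since `1 / (1 - p) = 1 + p / (1 - p)`
  have h2 : Real.exp (-(p / (1 - p))) ≤ 1 - p := by
    rw [Real.exp_neg, inv_le_comm₀ (Real.exp_pos _) h1]
    calc (1 - p)⁻¹ = p / (1 - p) + 1 := by field_simp; ring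
      _ ≤ _ := Real.add_one_le_exp _
  calc Real.exp (-(B / (1 - q))) ≤ Real.exp (-(p / (1 - p))) ^ T.card := by
        rw [← Real.exp_nat_mul, Real.exp_le_exp]
        have : p * T.card / (1 - p) ≤ B / (1 - q) :=
          div_le_div₀ (le_trans (by positivity) hB) hB (by linarith) (by linarith)
        calc -(B / (1 - q)) ≤ -(p * T.card / (1 - p)) := by linarith
          _ = _ := by ring
    _ ≤ (1 - p) ^ T.card := pow_le_pow_left₀ (Real.exp_pos _).le h2 _

end Placement

/-! ### Supportable traffic -/

section Supportable

variable {T : Type} [Fintype T] [DecidableEq T] {pos : T → Plane} {r Δ W : ℝ}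

/-- A time sharing may be described by any finite family of admissible sets with weights. -/
theorem supportable_of_family {Ω : Type*} [Fintype Ω] (w : Ω → ℝ) (act : Ω → Finset (T × T))
    (load : T → T → ℝ) (hw : ∀ ω, 0 ≤ w ω) (hc : ∀ ω, w ω ≠ 0 → Concurrent pos r Δ (act ω))
    (hs : ∑ ω, w ω ≤ 1)
    (hl : ∀ a b, load a b ≤ W * ∑ ω, if (a, b) ∈ act ω then w ω else 0) :
    Supportable pos r Δ W load := by
  refine ⟨fun A => ∑ ω with act ω = A, w ω, fun A => Finset.sum_nonneg fun ω _ => hw ω,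
    fun A hA => ?_, ?_, fun a b => (hl a b).trans_eq ?_⟩
  · obtain ⟨ω, hω, hne⟩ := Finset.exists_ne_zero_of_sum_ne_zero hA
    exact (Finset.mem_filter.1 hω).2 ▸ hc ω hne
  · rwa [Finset.sum_fiberwise]
  · congr 1
    rw [← Finset.sum_filter, ← Finset.sum_fiberwise_of_maps_to (g := act)
      (t := Finset.univ.filter fun A => (a, b) ∈ A)]
    · refine Finset.sum_congr rfl fun A hA => Finset.sum_congr ?_ fun _ _ => rfl
      ext ω
      simp only [Finset.mem_filter, Finset.mem_univ, true_and] at hA ⊢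
      exact ⟨fun h => h.2, fun h => ⟨h ▸ hA, h⟩⟩
    · intro ω hω
      simpa using hω

/-- If at most `k` links of `B` can be active simultaneously, then the total traffic on `B` is at
most `k` times the bandwidth. -/
theorem sum_load_le_of_supportable (hW : 0 ≤ W) {load : T → T → ℝ}
    (h : Supportable pos r Δ W load) (B : Finset (T × T)) (k : ℝ)
    (hk : ∀ A, Concurrent pos r Δ A → ((A ∩ B).card : ℝ) ≤ k) (hk0 : 0 ≤ k) :
    ∑ e ∈ B, load e.1 e.2 ≤ W * k := by
  obtain ⟨τ, h0, hc, hs, hl⟩ := h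
  calc ∑ e ∈ B, load e.1 e.2 ≤ ∑ e ∈ B, W * ∑ A with e ∈ A, τ A :=
        Finset.sum_le_sum fun e _ => hl e.1 e.2
    _ = W * ∑ A, ((A ∩ B).card : ℝ) * τ A := by
        rw [← Finset.mul_sum]
        simp only [Finset.sum_filter]
        rw [Finset.sum_comm]
        congr 1
        refine Finset.sum_congr rfl fun A _ => ?_
        rw [← Finset.sum_filter, Finset.sum_const, nsmul_eq_mul, Finset.filter_mem_eq_inter,
          Finset.inter_comm]
    _ ≤ W * ∑ A, k * τ A := by
        refine mul_le_mul_of_nonneg_left (Finset.sum_le_sum fun A _ => ?_) hW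
        by_cases hA : τ A = 0
        · simp [hA]
        · exact mul_le_mul_of_nonneg_right (hk A (hc A hA)) (h0 A)
    _ ≤ W * k := by
        rw [← Finset.mul_sum]
        exact mul_le_mul_of_nonneg_left (by nlinarith) hW

/-- Independent random choices: the weight of the choice functions with a given value at `i₀`. -/
theorem sum_prod_choice {I O : Type*} [Fintype I] [DecidableEq I] [Fintype O] [DecidableEq O]
    (π : I → O → ℝ) (h1 : ∀ i, ∑ o, π i o = 1) (i₀ : I) (o₀ : O) :
    ∑ F : I → O, (if F i₀ = o₀ then ∏ i, π i (F i) else 0) = π i₀ o₀ := by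
  have h := Finset.prod_univ_sum (fun _ : I => (Finset.univ : Finset O))
    (fun i o => if i = i₀ then (if o = o₀ then π i o else 0) else π i o)
  rw [Fintype.piFinset_univ] at h
  have hL : ∏ i, ∑ o, (if i = i₀ then (if o = o₀ then π i o else 0) else π i o) = π i₀ o₀ := by
    rw [Finset.prod_eq_single i₀]
    · simp
    · intro i _ hi; simp [hi, h1]
    · simp
  rw [← hL, h]
  refine Finset.sum_congr rfl fun F _ => ?_
  split_ifs with hF
  · refine Finset.prod_congr rfl fun i _ => ?_
    by_cases hi : i = i₀
    · subst hi; simp [hF]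
    · simp [hi]
  · exact (Finset.prod_eq_zero (Finset.mem_univ i₀) (by simp [hF])).symm

/-- Cellular scheduling.  Cells whose coordinates agree modulo `Q` are far enough apart to be
active at the same time, so each cell can be granted a `1 / Q ^ 2` share of the channel for the
links that leave it. -/
theorem supportable_of_cells (hW : 0 < W) (cell : T → ℤ × ℤ) (Q : ℕ) (hQ : 0 < Q)
    (hsep : ∀ a b, (Q : ℤ) ≤ |(cell a).1 - (cell b).1| ∨ (Q : ℤ) ≤ |(cell a).2 - (cell b).2| →
      (2 + Δ) * r ≤ dist (pos a) (pos b))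
    (load : T → T → ℝ) (h0 : ∀ a b, 0 ≤ load a b)
    (hadj : ∀ a b, load a b ≠ 0 → (commGraph pos r).Adj a b)
    (hload : ∀ c, (∑ e : T × T with cell e.1 = c, load e.1 e.2) * (Q : ℝ) ^ 2 ≤ W) :
    Supportable pos r Δ W load := by
  classical
  have : NeZero Q := ⟨hQ.ne'⟩
  have hQ' : (0 : ℝ) < (Q : ℝ) ^ 2 := by positivity
  let I := {c // c ∈ Finset.univ.image cell}
  have : Fintype I := inferInstanceAs (Fintype {c // c ∈ Finset.univ.image cell})
  let ci : T → I := fun a => ⟨cell a, Finset.mem_image_of_mem _ (Finset.mem_univ a)⟩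
  have ci_eq : ∀ a b, ci a = ci b ↔ cell a = cell b := fun a b => Subtype.ext_iff
  -- in every cell, a link is drawn at random in proportion to its load
  let f : I → T × T → ℝ := fun i e =>
    if cell e.1 = i.1 then load e.1 e.2 * (Q : ℝ) ^ 2 / W else 0
  let π : I → Option (T × T) → ℝ := fun i o => o.elim (1 - ∑ e, f i e) (f i)
  have hf0 : ∀ i e, 0 ≤ f i e := by
    intro i e
    simp only [f]
    split_ifs
    · exact div_nonneg (mul_nonneg (h0 _ _) hQ'.le) hW.le
    · exact le_rfl
  have hf1 : ∀ i, ∑ e, f i e ≤ 1 := by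
    intro i
    simp only [f]
    rw [← Finset.sum_filter, ← Finset.sum_div, ← Finset.sum_mul, div_le_one hW]
    exact hload i.1
  have hπ0 : ∀ i o, 0 ≤ π i o := by
    intro i o
    cases o with
    | none => simp only [π, Option.elim_none]; linarith [hf1 i]
    | some e => exact hf0 i e
  have hπ1 : ∀ i, ∑ o, π i o = 1 := by
    intro i; rw [Fintype.sum_option]; simp [π]
  let col : T → ZMod Q × ZMod Q := fun a => (((cell a).1 : ZMod Q), ((cell a).2 : ZMod Q))
  refine supportable_of_family (Ω := (ZMod Q × ZMod Q) × (I → Option (T × T)))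
    (fun ω => (1 / (Q : ℝ) ^ 2) * ∏ i, π i (ω.2 i))
    (fun ω => {e : T × T | ω.2 (ci e.1) = some e ∧ col e.1 = ω.1}) load
    (fun ω => mul_nonneg (by positivity) (Finset.prod_nonneg fun i _ => hπ0 _ _)) ?_ ?_ ?_
  · intro ω hω
    have hne : ∀ i, π i (ω.2 i) ≠ 0 := by
      intro i
      exact Finset.prod_ne_zero_iff.1 (right_ne_zero_of_mul hω) i (Finset.mem_univ i)
    have hA : ∀ e : T × T, ω.2 (ci e.1) = some e → (commGraph pos r).Adj e.1 e.2 := by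
      intro e he
      apply hadj
      have := hne (ci e.1)
      rw [he] at this
      intro h
      apply this
      simp [π, f, ci, h]
    refine ⟨fun e he => hA e (by simpa using (Finset.mem_filter.1 he).2.1), fun e he e' he' hee => ?_⟩
    obtain ⟨h1, h2⟩ := (Finset.mem_filter.1 he).2
    obtain ⟨h1', h2'⟩ := (Finset.mem_filter.1 he').2
    have hcell : cell e'.1 ≠ cell e.1 := by
      intro h
      rw [(ci_eq _ _).2 h, h1] at h1'
      exact hee (Option.some_injective _ h1')
    have hcol : col e'.1 = col e.1 := h2'.trans h2.symm
    have key : ∀ x y : ℤ, (x : ZMod Q) = (y : ZMod Q) → x ≠ y → (Q : ℤ) ≤ |x - y| := by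
      intro x y h hxy
      have hd : (Q : ℤ) ∣ x - y := by
        rw [← ZMod.intCast_zmod_eq_zero_iff_dvd, Int.cast_sub, h, sub_self]
      exact Int.le_of_dvd (abs_pos.2 (sub_ne_zero.2 hxy)) ((dvd_abs _ _).2 hd)
    have hfar : (2 + Δ) * r ≤ dist (pos e'.1) (pos e.1) := by
      apply hsep
      by_cases hx : (cell e'.1).1 = (cell e.1).1
      · right
        exact key _ _ (congrArg Prod.snd hcol) fun hy => hcell (Prod.ext hx hy)
      · left
        exact key _ _ (congrArg Prod.fst hcol) hx
    have hnear := (hA e h1).2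
    have := dist_triangle_right (pos e'.1) (pos e.1) (pos e.2)
    linarith
  · rw [Fintype.sum_prod_type]
    simp only
    rw [Finset.sum_const, ← Finset.mul_sum]
    have := Finset.prod_univ_sum (fun _ : I => (Finset.univ : Finset (Option (T × T)))) π
    rw [Fintype.piFinset_univ] at this
    rw [← this]
    simp only [hπ1, Finset.prod_const_one, Finset.card_univ, Fintype.card_prod, ZMod.card,
      nsmul_eq_mul]
    push_cast
    apply le_of_eq
    field_simp
  · intro a b
    apply le_of_eq
    rw [Fintype.sum_prod_type, Finset.sum_eq_single (col a)]
    · simp only [Finset.mem_filter, Finset.mem_univ, true_and, and_true]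
      have := sum_prod_choice π hπ1 (ci a) (some (a, b))
      simp only [← mul_ite_zero, ← Finset.mul_sum]
      rw [this]
      simp only [π, f, ci, Option.elim_some, if_true]
      field_simp
    · intro h _ hh
      exact Finset.sum_eq_zero fun F _ => by simp [hh.symm]
    · simp

end Supportable

/-! ### Existence and bounds of the capacity -/

section Capacity

variable {U T : Type} [Fintype U] [Fintype T] [DecidableEq T] {m : ℕ}
  {pos : T → Plane} {r Δ W : ℝ} {α ρ : Fin m → ℝ} {D : Delivery U T}

omit [Fintype T] in
theorem linkLoad_eq_mul (γ : ℝ) (a b : T) :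
    linkLoad α ρ D γ a b = γ * linkLoad α ρ D 1 a b := by
  simp [linkLoad]

/-- The supremum of the achievable rates is attained: the pairs of a rate and a time sharing that
supports it form a compact set, as long as the rate is bounded. -/
theorem capacityBetween_of_bounds {lo hi : ℝ}
    (hlo : lo ∈ achievableRates pos r Δ W α ρ D)
    (hhi : ∀ γ ∈ achievableRates pos r Δ W α ρ D, γ ≤ hi) :
    CapacityBetween pos r Δ W α ρ D lo hi := by
  classical
  let F : Set (ℝ × (Finset (T × T) → ℝ)) :=
    (Set.Icc 0 hi ×ˢ Set.univ.pi fun _ => Set.Icc 0 1) ∩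
      {x | (∀ A, ¬ Concurrent pos r Δ A → x.2 A = 0) ∧ ∑ A, x.2 A ≤ 1 ∧
        ∀ a b, x.1 * linkLoad α ρ D 1 a b ≤ W * ∑ A with (a, b) ∈ A, x.2 A}
  have hF : IsCompact F := by
    refine IsCompact.inter_right (isCompact_Icc.prod (isCompact_univ_pi fun _ => isCompact_Icc)) ?_
    simp only [Set.ofPred_and, Set.ofPred_forall]
    refine IsClosed.inter ?_ (IsClosed.inter ?_ ?_)
    · exact isClosed_iInter fun A => isClosed_iInter fun _ =>
        isClosed_eq (by fun_prop) continuous_const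
    · exact isClosed_le (by fun_prop) continuous_const
    · exact isClosed_iInter fun a => isClosed_iInter fun b =>
        isClosed_le (by fun_prop) (by fun_prop)
  have hmem : ∀ γ ∈ achievableRates pos r Δ W α ρ D, ∃ τ, (γ, τ) ∈ F := by
    intro γ hγ
    obtain ⟨hγ0, τ, h0, hc, hs, hl⟩ := id hγ
    refine ⟨τ, ⟨⟨⟨hγ0, hhi γ hγ⟩, fun A _ => ⟨h0 A, ?_⟩⟩, fun A hA => ?_, hs, fun a b => ?_⟩⟩
    · exact (Finset.single_le_sum (fun B _ => h0 B) (Finset.mem_univ A)).trans hs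
    · by_contra h
      exact hA (hc A h)
    · exact (linkLoad_eq_mul γ a b).symm.trans_le (hl a b)
  obtain ⟨τ₀, hτ₀⟩ := hmem lo hlo
  obtain ⟨⟨γ, τ⟩, hx, hmax⟩ := hF.exists_isMaxOn ⟨_, hτ₀⟩ continuous_fst.continuousOn
  refine ⟨γ, ⟨⟨hx.1.1.1, τ, fun A => (hx.1.2 A trivial).1, fun A hA => ?_, hx.2.2.1,
    fun a b => ?_⟩, fun γ' hγ' => ?_⟩, hmax hτ₀, hx.1.1.2⟩
  · by_contra h
    exact hA (hx.2.1 A h)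
  · exact (linkLoad_eq_mul γ a b).trans_le (hx.2.2.2 a b)
  · obtain ⟨τ', hτ'⟩ := hmem γ' hγ'
    exact hmax hτ'

omit [Fintype T] in
/-- The traffic on a set `B` of links, in terms of the mean number of hops of a download that
belong to `B`. -/
theorem sum_linkLoad (γ : ℝ) (B : Finset (T × T)) :
    ∑ e ∈ B, linkLoad α ρ D γ e.1 e.2 =
      γ * ∑ v : U, ∑ k : Fin m, α k * ∑ S : Finset U, placementProb (ρ k) S *
        ((B.filter fun e => [e.2, e.1] <:+: D v S).card : ℝ) := by
  simp only [linkLoad]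
  rw [← Finset.mul_sum, Finset.sum_comm]
  congr 1
  refine Finset.sum_congr rfl fun v _ => ?_
  rw [Finset.sum_comm]
  refine Finset.sum_congr rfl fun k _ => ?_
  rw [← Finset.mul_sum, Finset.sum_comm]
  congr 1
  refine Finset.sum_congr rfl fun S _ => ?_
  rw [← Finset.mul_sum, Finset.sum_boole]

/-- Converse bound: if at most `j` links of `B` can be active simultaneously, while each of the
users of `V` fetches content `k` through a link of `B` with probability at least `ε`, then these
users share a rate `j W`. -/
theorem rate_mul_le (hα : ∀ k, 0 ≤ α k) (hρ : ∀ k, 0 ≤ ρ k ∧ ρ k ≤ 1) (hW : 0 ≤ W) {γ : ℝ}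
    (hγ : γ ∈ achievableRates pos r Δ W α ρ D) (B : Finset (T × T)) (j : ℝ) (hj : 0 ≤ j)
    (hB : ∀ A, Concurrent pos r Δ A → ((A ∩ B).card : ℝ) ≤ j) (V : Finset U) (k : Fin m) (ε : ℝ)
    (hε : ∀ v ∈ V, ε ≤ eventProb (ρ k) fun S => ∃ e ∈ B, [e.2, e.1] <:+: D v S) :
    γ * (α k * (V.card * ε)) ≤ W * j := by
  classical
  refine le_trans ?_ (sum_load_le_of_supportable hW hγ.2 B j hB hj)
  rw [sum_linkLoad]
  refine mul_le_mul_of_nonneg_left ?_ hγ.1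
  have hP : ∀ k S, 0 ≤ placementProb (U := U) (ρ k) S :=
    fun k S => placementProb_nonneg (hρ k).1 (hρ k).2 S
  have hnn : ∀ v k, 0 ≤ α k * ∑ S : Finset U, placementProb (ρ k) S *
      ((B.filter fun e => [e.2, e.1] <:+: D v S).card : ℝ) := fun v k =>
    mul_nonneg (hα k) (Finset.sum_nonneg fun S _ => mul_nonneg (hP k S) (Nat.cast_nonneg _))
  calc α k * (V.card * ε) = ∑ v ∈ V, α k * ε := by
        rw [Finset.sum_const, nsmul_eq_mul]; ring
    _ ≤ ∑ v ∈ V, α k * ∑ S : Finset U, placementProb (ρ k) S *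
        ((B.filter fun e => [e.2, e.1] <:+: D v S).card : ℝ) := by
        refine Finset.sum_le_sum fun v hv => mul_le_mul_of_nonneg_left ((hε v hv).trans ?_) (hα k)
        refine Finset.sum_le_sum fun S _ => mul_le_mul_of_nonneg_left ?_ (hP k S)
        split_ifs with h
        · obtain ⟨e, he, hi⟩ := h
          exact_mod_cast Finset.card_pos.2 ⟨e, Finset.mem_filter.2 ⟨he, hi⟩⟩
        · positivity
    _ ≤ ∑ v, α k * ∑ S : Finset U, placementProb (ρ k) S *
        ((B.filter fun e => [e.2, e.1] <:+: D v S).card : ℝ) :=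
        Finset.sum_le_univ_sum_of_nonneg fun v => hnn v k
    _ ≤ _ := Finset.sum_le_sum fun v _ =>
        Finset.single_le_sum (fun k _ => hnn v k) (Finset.mem_univ k)

/-- Two hops of the same download whose transmitters lie in the same cell coincide, if the
stations after the user lie in distinct cells. -/
theorem card_hops_le {ι : Type*} [DecidableEq ι] (cell : T → ι) (l : List T)
    (hl : (l.tail.map cell).Nodup) (c : ι) :
    (Finset.card {e : T × T | cell e.1 = c ∧ [e.2, e.1] <:+: l} : ℝ) ≤
      if c ∈ l.tail.map cell then 1 else 0 := by
  have hidx : ∀ e : T × T, cell e.1 = c → [e.2, e.1] <:+: l →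
      ∃ i : ℕ, l[i]? = some e.2 ∧ l.tail[i]? = some e.1 ∧
        (l.tail.map cell)[i]? = some c := by
    rintro ⟨a, b⟩ hc ⟨s, t, rfl⟩
    have h1 : (s ++ [b, a] ++ t).tail[s.length]? = some a := by
      rw [List.getElem?_tail]
      simp
    refine ⟨s.length, by simp, h1, ?_⟩
    rw [List.getElem?_map, h1]
    simpa using hc
  split_ifs with h
  · have : Finset.card {e : T × T | cell e.1 = c ∧ [e.2, e.1] <:+: l} ≤ 1 := by
      rw [Finset.card_le_one]
      intro e he e' he'
      simp only [Finset.mem_filter, Finset.mem_univ, true_and] at he he'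
      obtain ⟨i, h1, h2, h3⟩ := hidx e he.1 he.2
      obtain ⟨i', h1', h2', h3'⟩ := hidx e' he'.1 he'.2
      have hi : i < (l.tail.map cell).length := (List.getElem?_eq_some_iff.1 h3).1
      obtain rfl : i = i' := (List.getElem?_inj hi hl).1 (h3.trans h3'.symm)
      rw [h1] at h1'
      rw [h2] at h2'
      exact Prod.ext (Option.some_injective _ h2') (Option.some_injective _ h1')
    exact_mod_cast this
  · have : Finset.card {e : T × T | cell e.1 = c ∧ [e.2, e.1] <:+: l} = 0 := by
      rw [Finset.card_eq_zero, Finset.filter_eq_empty_iff]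
      rintro e - ⟨he, hi⟩
      obtain ⟨i, -, -, h3⟩ := hidx e he hi
      exact h (List.mem_of_getElem? h3)
    simp [this]

/-- Direct bound: a rate is achievable by cellular scheduling if no cell has to transmit more
than the share of the channel that it is granted. -/
theorem mem_achievableRates_of_cells (hα : ∀ k, 0 ≤ α k) (hα1 : ∑ k, α k = 1)
    (hρ : ∀ k, 0 ≤ ρ k ∧ ρ k ≤ 1) (hW : 0 < W) (cell : T → ℤ × ℤ) (Q : ℕ) (hQ : 0 < Q)
    (hsep : ∀ a b, (Q : ℤ) ≤ |(cell a).1 - (cell b).1| ∨ (Q : ℤ) ≤ |(cell a).2 - (cell b).2| →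
      (2 + Δ) * r ≤ dist (pos a) (pos b))
    (hadj : ∀ v S a b, [b, a] <:+: D v S → (commGraph pos r).Adj a b)
    (hnodup : ∀ v S, ((D v S).tail.map cell).Nodup) (L : ℝ)
    (hL : ∀ c k, ∑ v, eventProb (ρ k) (fun S => c ∈ (D v S).tail.map cell) ≤ L)
    {γ : ℝ} (hγ : 0 ≤ γ) (hγL : γ * L * (Q : ℝ) ^ 2 ≤ W) :
    γ ∈ achievableRates pos r Δ W α ρ D := by
  classical
  have hP : ∀ k S, 0 ≤ placementProb (U := U) (ρ k) S :=
    fun k S => placementProb_nonneg (hρ k).1 (hρ k).2 S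
  refine ⟨hγ, supportable_of_cells hW cell Q hQ hsep _ (fun a b => ?_) (fun a b h => ?_)
    fun c => ?_⟩
  · refine mul_nonneg hγ (Finset.sum_nonneg fun v _ => Finset.sum_nonneg fun k _ =>
      mul_nonneg (hα k) (Finset.sum_nonneg fun S _ => mul_nonneg (hP k S) ?_))
    split_ifs <;> norm_num
  · by_contra hna
    apply h
    have : ∀ v S, ¬ [b, a] <:+: D v S := fun v S hi => hna (hadj v S a b hi)
    simp [linkLoad, this]
  · refine le_trans (mul_le_mul_of_nonneg_right ?_ (by positivity)) hγL
    rw [sum_linkLoad]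
    refine mul_le_mul_of_nonneg_left ?_ hγ
    calc ∑ v : U, ∑ k : Fin m, α k * ∑ S : Finset U, placementProb (ρ k) S *
          (((Finset.univ.filter fun e : T × T => cell e.1 = c).filter
            fun e => [e.2, e.1] <:+: D v S).card : ℝ)
        ≤ ∑ v : U, ∑ k : Fin m, α k *
          eventProb (ρ k) (fun S => c ∈ (D v S).tail.map cell) := by
          refine Finset.sum_le_sum fun v _ => Finset.sum_le_sum fun k _ =>
            mul_le_mul_of_nonneg_left (Finset.sum_le_sum fun S _ =>
              mul_le_mul_of_nonneg_left ?_ (hP k S)) (hα k)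
          rw [Finset.filter_filter]
          refine le_of_eq_of_le ?_ ((card_hops_le cell (D v S) (hnodup v S) c).trans_eq ?_)
          · congr!
          · congr!
      _ = ∑ k : Fin m, α k * ∑ v : U, eventProb (ρ k) (fun S => c ∈ (D v S).tail.map cell) := by
          rw [Finset.sum_comm]; simp only [Finset.mul_sum]
      _ ≤ ∑ k : Fin m, α k * L :=
          Finset.sum_le_sum fun k _ => mul_le_mul_of_nonneg_left (hL c k) (hα k)
      _ = L := by rw [← Finset.sum_mul, hα1, one_mul]

/-- The links that leave a given station exclude each other. -/
theorem card_inter_out_le_one (hr : 0 < r) (hΔ : 0 < Δ) (s : T) {A : Finset (T × T)}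
    (hA : Concurrent pos r Δ A) :
    ((A ∩ Finset.univ.filter fun e : T × T => e.1 = s).card : ℝ) ≤ 1 := by
  have : (A ∩ Finset.univ.filter fun e : T × T => e.1 = s).card ≤ 1 := by
    rw [Finset.card_le_one]
    intro e he e' he'
    simp only [Finset.mem_inter, Finset.mem_filter, Finset.mem_univ, true_and] at he he'
    by_contra hne
    have h1 := hA.2 e he.1 e' he'.1 hne
    have h2 := (hA.1 e he.1).2
    rw [he'.2, ← he.2] at h1
    nlinarith
  exact_mod_cast this

/-- A list of at least two stations that ends in `s` has a hop with transmitter `s`. -/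
theorem exists_hop_of_getLast {l : List T} {s : T} {l' : List T} (hl : l = l' ++ [s])
    (hne : l' ≠ []) : ∃ e ∈ Finset.univ.filter fun e : T × T => e.1 = s, [e.2, e.1] <:+: l := by
  refine ⟨(s, l'.getLast hne), by simp, l'.dropLast, [], ?_⟩
  conv_rhs => rw [hl, ← List.dropLast_append_getLast hne]
  simp

end Capacity

/-! ### Taxicab geometry of grids and cells -/

/-- The taxicab distance of two cells. -/
def taxi (c d : ℤ × ℤ) : ℕ := (c.1 - d.1).natAbs + (c.2 - d.2).natAbs

theorem taxi_triangle (a b c : ℤ × ℤ) : taxi a c ≤ taxi a b + taxi b c := by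
  simp only [taxi]; omega

theorem taxi_comm (a b : ℤ × ℤ) : taxi a b = taxi b a := by
  simp only [taxi]; omega

theorem taxi_self (a : ℤ × ℤ) : taxi a a = 0 := by
  simp [taxi]

/-- Local conditions under which the graph distance of `G` is the taxicab distance of the
coordinates `g`: every edge is a unit step, and from any vertex some edge leads closer to any other
vertex. -/
def IsTaxicab {V : Type*} (G : SimpleGraph V) (g : V → ℤ × ℤ) : Prop :=
  (∀ a b, G.Adj a b → taxi (g a) (g b) = 1) ∧
    ∀ v w, v ≠ w → ∃ u, G.Adj v u ∧ taxi (g u) (g w) + 1 = taxi (g v) (g w)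

namespace IsTaxicab

variable {V : Type*} {G : SimpleGraph V} {g : V → ℤ × ℤ}

theorem taxi_le_length (h : IsTaxicab G g) {v w : V} (p : G.Walk v w) :
    taxi (g v) (g w) ≤ p.length := by
  induction p with
  | nil => simp [taxi_self]
  | @cons a b c hadj p ih =>
    rw [SimpleGraph.Walk.length_cons]
    have := h.1 _ _ hadj
    have := taxi_triangle (g a) (g b) (g c)
    omega

theorem exists_walk (h : IsTaxicab G g) (v w : V) :
    ∃ p : G.Walk v w, p.length = taxi (g v) (g w) := by
  induction hd : taxi (g v) (g w) generalizing v with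
  | zero =>
    obtain rfl : v = w := by
      by_contra hne
      obtain ⟨u, -, hu⟩ := h.2 v w hne
      omega
    exact ⟨.nil, rfl⟩
  | succ d ih =>
    have hne : v ≠ w := by rintro rfl; simp [taxi_self] at hd
    obtain ⟨u, hadj, hu⟩ := h.2 v w hne
    obtain ⟨p, hp⟩ := ih u (by omega)
    exact ⟨.cons hadj p, by simp [hp]⟩

theorem dist_eq (h : IsTaxicab G g) (v w : V) : G.dist v w = taxi (g v) (g w) := by
  obtain ⟨p, hp⟩ := h.exists_walk v w
  obtain ⟨q, hq⟩ := p.reachable.exists_walk_length_eq_dist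
  exact le_antisymm (hp ▸ SimpleGraph.dist_le p) (hq ▸ h.taxi_le_length q)

/-- A shortest walk is at distance `i` from its start after `i` steps. -/
theorem taxi_getVert (h : IsTaxicab G g) {v w : V} {p : G.Walk v w}
    (hp : p.length = taxi (g v) (g w)) {i : ℕ} (hi : i ≤ p.length) :
    taxi (g v) (g (p.getVert i)) = i ∧ taxi (g (p.getVert i)) (g w) = p.length - i := by
  have h1 := h.taxi_le_length (p.take i)
  have h2 := h.taxi_le_length (p.drop i)
  rw [SimpleGraph.Walk.take_length] at h1
  rw [SimpleGraph.Walk.drop_length] at h2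
  have := taxi_triangle (g v) (g (p.getVert i)) (g w)
  omega

theorem getVert_inj (h : IsTaxicab G g) {v w : V} {p : G.Walk v w}
    (hp : p.length = taxi (g v) (g w)) {i j : ℕ} (hi : i ≤ p.length) (hj : j ≤ p.length)
    (hij : p.getVert i = p.getVert j) : i = j := by
  rw [← (h.taxi_getVert hp hi).1, ← (h.taxi_getVert hp hj).1, hij]

end IsTaxicab

/-- At most `4 d + 2` cells lie at taxicab distance `d`: the first coordinate takes at most
`2 d + 1` values, and determines the second one up to a reflection. -/
theorem card_taxi_eq_le (F : Finset (ℤ × ℤ)) (c : ℤ × ℤ) (d : ℕ) :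
    (F.filter fun x => taxi x c = d).card ≤ 4 * d + 2 := by
  calc (F.filter fun x => taxi x c = d).card
      ≤ (Finset.Icc (-(d : ℤ)) d ×ˢ (Finset.univ : Finset Bool)).card := by
        refine Finset.card_le_card_of_injOn (fun x => (x.1 - c.1, decide (c.2 ≤ x.2))) ?_ ?_
        · intro x hx
          have hx' := (Finset.mem_filter.1 (Finset.mem_coe.1 hx)).2
          simp only [taxi] at hx'
          simp only [Finset.coe_product, Finset.coe_univ, Set.mem_prod, Finset.coe_Icc,
            Set.mem_Icc, Set.mem_univ, and_true]
          omega
        · intro x hx y hy hxy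
          have hx' := (Finset.mem_filter.1 (Finset.mem_coe.1 hx)).2
          have hy' := (Finset.mem_filter.1 (Finset.mem_coe.1 hy)).2
          simp only [taxi] at hx' hy'
          simp only [Prod.mk.injEq, decide_eq_decide] at hxy
          obtain ⟨h1, h2⟩ := hxy
          refine Prod.ext (by omega) ?_
          by_cases h : c.2 ≤ x.2
          · have := h2.1 h; omega
          · have : ¬ c.2 ≤ y.2 := fun h' => h (h2.2 h'); omega
    _ = 4 * d + 2 := by
        rw [Finset.card_product, Int.card_Icc, Finset.card_univ, Fintype.card_bool]
        omega

/-- Summation over taxicab spheres, when each cell contains at most `κ` users. -/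
theorem sum_taxi_le {U : Type*} [Fintype U] (cell : U → ℤ × ℤ) (κ : ℝ) (hκ0 : 0 ≤ κ)
    (hκ : ∀ c, (Finset.card {u | cell u = c} : ℝ) ≤ κ) (c : ℤ × ℤ) (g : ℕ → ℝ)
    (hg : ∀ d, 0 ≤ g d) (B : ℝ) (hB : ∀ D, ∑ d ∈ Finset.range D, (4 * d + 2) * g d ≤ B) :
    ∑ u, g (taxi (cell u) c) ≤ κ * B := by
  classical
  set F := Finset.univ.image cell
  have h1 : ∑ u, g (taxi (cell u) c) = ∑ x ∈ F, (Finset.card {u | cell u = x} : ℝ) *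
      g (taxi x c) := by
    rw [← Finset.sum_fiberwise_of_maps_to (g := cell) (t := F)
      (fun u _ => Finset.mem_image_of_mem _ (Finset.mem_univ u))]
    refine Finset.sum_congr rfl fun x _ => ?_
    rw [← nsmul_eq_mul, ← Finset.sum_const]
    exact Finset.sum_congr rfl fun u hu => by rw [(Finset.mem_filter.1 hu).2]
  obtain ⟨D, hD⟩ : ∃ D, ∀ x ∈ F, taxi x c ∈ Finset.range D := by
    refine ⟨F.sup (fun x => taxi x c) + 1, fun x hx => ?_⟩
    rw [Finset.mem_range, Nat.lt_succ_iff]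
    exact Finset.le_sup (f := fun x => taxi x c) hx
  calc ∑ u, g (taxi (cell u) c) ≤ ∑ x ∈ F, κ * g (taxi x c) := by
        rw [h1]
        exact Finset.sum_le_sum fun x _ => mul_le_mul_of_nonneg_right (hκ x) (hg _)
    _ = κ * ∑ d ∈ Finset.range D, ((F.filter fun x => taxi x c = d).card : ℝ) * g d := by
        rw [← Finset.mul_sum, ← Finset.sum_fiberwise_of_maps_to hD]
        congr 1
        refine Finset.sum_congr rfl fun d _ => ?_
        rw [← nsmul_eq_mul, ← Finset.sum_const]
        exact Finset.sum_congr rfl fun u hu => by rw [(Finset.mem_filter.1 hu).2]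
    _ ≤ κ * B := by
        refine mul_le_mul_of_nonneg_left (le_trans ?_ (hB D)) hκ0
        refine Finset.sum_le_sum fun d _ => mul_le_mul_of_nonneg_right ?_ (hg d)
        exact_mod_cast card_taxi_eq_le F c d

/-! ### Sums over spheres -/

theorem sum_succ_mul_pow_le {x : ℝ} (h0 : 0 ≤ x) (h1 : x < 1) (D : ℕ) :
    ∑ d ∈ Finset.range D, ((d : ℝ) + 1) * x ^ d ≤ 1 / (1 - x) ^ 2 := by
  have key : (1 - x) ^ 2 * ∑ d ∈ Finset.range D, ((d : ℝ) + 1) * x ^ d =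
      1 - (1 - x) * D * x ^ D - x ^ D := by
    induction D with
    | zero => simp
    | succ D ih => rw [Finset.sum_range_succ, mul_add, ih]; push_cast; ring
  rw [le_div_iff₀ (by have : 0 < 1 - x := by linarith
                      positivity), mul_comm, key]
  have h2 : 0 ≤ (1 - x) * D * x ^ D :=
    mul_nonneg (mul_nonneg (by linarith) (Nat.cast_nonneg _)) (pow_nonneg h0 _)
  linarith [pow_nonneg h0 D]

theorem inv_one_sub_exp_neg_le {y : ℝ} (hy : 0 < y) :
    0 < 1 - Real.exp (-y) ∧ 1 / (1 - Real.exp (-y)) ≤ 1 + 1 / y := by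
  have h1 : 0 < 1 - Real.exp (-y) := by
    have : Real.exp (-y) < 1 := by rw [Real.exp_lt_one_iff]; linarith
    linarith
  refine ⟨h1, ?_⟩
  have h2 : Real.exp (-y) ≤ 1 / (1 + y) := by
    rw [Real.exp_neg, ← one_div]
    exact one_div_le_one_div_of_le (by linarith) (by linarith [Real.add_one_le_exp y])
  have h3 : y / (1 + y) ≤ 1 - Real.exp (-y) := by
    have : y / (1 + y) = 1 - 1 / (1 + y) := by field_simp; ring
    linarith
  calc 1 / (1 - Real.exp (-y)) ≤ 1 / (y / (1 + y)) :=
        one_div_le_one_div_of_le (by positivity) h3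
    _ = 1 + 1 / y := by field_simp; ring

/-- Spheres weighted by `exp (-y (d - 1))`, where the subtraction is truncated: the weight is `1`
at the distances `0` and `1`. -/
theorem sum_sphere_exp_le {y : ℝ} (hy : 0 < y) (D : ℕ) :
    ∑ d ∈ Finset.range D, (4 * (d : ℝ) + 2) * Real.exp (-(y * ((d - 1 : ℕ) : ℝ))) ≤
      8 * (1 + 1 / y) ^ 2 := by
  obtain ⟨h1, h2⟩ := inv_one_sub_exp_neg_le hy
  have hle : 1 ≤ (1 + 1 / y) ^ 2 := by
    have : 0 < 1 / y := by positivity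
    nlinarith
  cases D with
  | zero => simp; positivity
  | succ D =>
    rw [Finset.sum_range_succ']
    have h3 : ∑ d ∈ Finset.range D, (4 * ((d + 1 : ℕ) : ℝ) + 2) *
        Real.exp (-(y * ((d + 1 - 1 : ℕ) : ℝ))) ≤
        6 * ∑ d ∈ Finset.range D, ((d : ℝ) + 1) * Real.exp (-y) ^ d := by
      rw [Finset.mul_sum]
      refine Finset.sum_le_sum fun d _ => ?_
      rw [Nat.add_sub_cancel, ← Real.exp_nat_mul, ← mul_assoc]
      have : (d : ℝ) * -y = -(y * d) := by ring
      rw [this]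
      refine mul_le_mul_of_nonneg_right ?_ (Real.exp_pos _).le
      push_cast
      have : (0 : ℝ) ≤ d := Nat.cast_nonneg d
      linarith
    have h4 := sum_succ_mul_pow_le (Real.exp_pos (-y)).le (by linarith) D
    have h5 : 1 / (1 - Real.exp (-y)) ^ 2 ≤ (1 + 1 / y) ^ 2 := by
      rw [← one_div_pow]
      exact pow_le_pow_left₀ (by positivity) h2 2
    simp only [Nat.cast_zero, Nat.zero_sub, mul_zero, neg_zero, Real.exp_zero, zero_add, mul_one]
    linarith

/-- Spheres weighted by `exp (-y d)`. -/
theorem sum_sphere_exp_le' {y : ℝ} (hy : 0 < y) (hy1 : y ≤ 1) (D : ℕ) :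
    ∑ d ∈ Finset.range D, (4 * (d : ℝ) + 2) * Real.exp (-(y * d)) ≤ 32 / y ^ 2 := by
  calc ∑ d ∈ Finset.range D, (4 * (d : ℝ) + 2) * Real.exp (-(y * d))
      ≤ ∑ d ∈ Finset.range D, (4 * (d : ℝ) + 2) * Real.exp (-(y * ((d - 1 : ℕ) : ℝ))) := by
        refine Finset.sum_le_sum fun d _ => mul_le_mul_of_nonneg_left ?_ (by positivity)
        rw [Real.exp_le_exp, neg_le_neg_iff]
        refine mul_le_mul_of_nonneg_left ?_ hy.le
        exact_mod_cast Nat.sub_le d 1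
    _ ≤ 8 * (1 + 1 / y) ^ 2 := sum_sphere_exp_le hy D
    _ ≤ 8 * (2 / y) ^ 2 := by
        have : 1 + 1 / y ≤ 2 / y := by
          have := one_le_one_div hy hy1
          have h : 2 / y = 1 / y + 1 / y := by ring
          linarith
        gcongr
    _ = 32 / y ^ 2 := by ring

/-- Spheres with Gaussian weights.  The bound is by comparison with the telescoping sum of
`1 / (1 + s d ^ 2)`, where `s = y / 4`. -/
theorem sum_sphere_gauss_le {y : ℝ} (hy : 0 < y) (hy1 : y ≤ 1) (D : ℕ) :
    ∑ d ∈ Finset.range D, (4 * (d : ℝ) + 2) * Real.exp (-(y * (d : ℝ) ^ 2)) ≤ 24 / y := by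
  set u : ℕ → ℝ := fun d => 1 / (1 + y / 4 * (d : ℝ) ^ 2)
  have hterm : ∀ d : ℕ, (4 * (d : ℝ) + 2) * Real.exp (-(y * (d : ℝ) ^ 2)) ≤
      24 / y * (u d - u (d + 1)) := by
    intro d
    have hd : (0 : ℝ) ≤ d := Nat.cast_nonneg d
    have e1 : u d - u (d + 1) = y / 4 * (2 * d + 1) /
        ((1 + y / 4 * (d : ℝ) ^ 2) * (1 + y / 4 * ((d : ℝ) + 1) ^ 2)) := by
      simp only [u]; push_cast; field_simp; ring
    have e2 : Real.exp (-(y * (d : ℝ) ^ 2)) ≤ 1 / (1 + y / 2 * (d : ℝ) ^ 2) ^ 2 := by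
      have : Real.exp (-(y * (d : ℝ) ^ 2)) = 1 / Real.exp (y / 2 * (d : ℝ) ^ 2) ^ 2 := by
        rw [← Real.exp_nat_mul, one_div, ← Real.exp_neg]; congr 1; push_cast; ring
      rw [this]
      refine one_div_le_one_div_of_le (by positivity) (pow_le_pow_left₀ (by positivity) ?_ 2)
      linarith [Real.add_one_le_exp (y / 2 * (d : ℝ) ^ 2)]
    have e3 : (1 + y / 4 * (d : ℝ) ^ 2) * (1 + y / 4 * ((d : ℝ) + 1) ^ 2) ≤
        3 * (1 + y / 2 * (d : ℝ) ^ 2) ^ 2 := by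
      have a1 : 1 + y / 4 * (d : ℝ) ^ 2 ≤ 1 + y / 2 * (d : ℝ) ^ 2 := by
        have : 0 ≤ y / 4 * (d : ℝ) ^ 2 := by positivity
        linarith
      have a2 : 1 + y / 4 * ((d : ℝ) + 1) ^ 2 ≤ 3 * (1 + y / 2 * (d : ℝ) ^ 2) := by
        have : ((d : ℝ) + 1) ^ 2 ≤ 2 * (d : ℝ) ^ 2 + 2 := by nlinarith [sq_nonneg ((d : ℝ) - 1)]
        have : y / 4 * ((d : ℝ) + 1) ^ 2 ≤ y / 4 * (2 * (d : ℝ) ^ 2 + 2) :=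
          mul_le_mul_of_nonneg_left this (by positivity)
        have : 0 ≤ y * (d : ℝ) ^ 2 := by positivity
        linarith
      calc _ ≤ (1 + y / 2 * (d : ℝ) ^ 2) * (3 * (1 + y / 2 * (d : ℝ) ^ 2)) :=
            mul_le_mul a1 a2 (by positivity) (by positivity)
        _ = _ := by ring
    rw [e1]
    calc (4 * (d : ℝ) + 2) * Real.exp (-(y * (d : ℝ) ^ 2))
        ≤ (4 * (d : ℝ) + 2) * (1 / (1 + y / 2 * (d : ℝ) ^ 2) ^ 2) :=
          mul_le_mul_of_nonneg_left e2 (by positivity)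
      _ = 3 * (4 * d + 2) * (1 / (3 * (1 + y / 2 * (d : ℝ) ^ 2) ^ 2)) := by field_simp
      _ ≤ 3 * (4 * d + 2) * (1 / ((1 + y / 4 * (d : ℝ) ^ 2) * (1 + y / 4 * ((d : ℝ) + 1) ^ 2))) :=
          mul_le_mul_of_nonneg_left (one_div_le_one_div_of_le (by positivity) e3) (by positivity)
      _ = _ := by field_simp; ring
  calc _ ≤ ∑ d ∈ Finset.range D, 24 / y * (u d - u (d + 1)) :=
        Finset.sum_le_sum fun d _ => hterm d
    _ = 24 / y * (u 0 - u D) := by rw [← Finset.mul_sum, Finset.sum_range_sub']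
    _ ≤ 24 / y * 1 := by
        refine mul_le_mul_of_nonneg_left ?_ (by positivity)
        have : 0 ≤ u D := by positivity
        have : u 0 = 1 := by simp [u]
        linarith
    _ = 24 / y := mul_one _

/-! ### Distances in the plane, and sizes of boxes -/

theorem plane_dist_sq (p q : Plane) : dist p q ^ 2 = (p 0 - q 0) ^ 2 + (p 1 - q 1) ^ 2 := by
  rw [EuclideanSpace.dist_eq, Real.sq_sqrt (Finset.sum_nonneg fun i _ => sq_nonneg _),
    Fin.sum_univ_two, Real.dist_eq, Real.dist_eq, sq_abs, sq_abs]

theorem abs_sub_le_plane_dist (p q : Plane) (i : Fin 2) : |p i - q i| ≤ dist p q := by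
  refine abs_le_of_sq_le_sq ?_ dist_nonneg
  rw [plane_dist_sq]
  fin_cases i
  · simpa using sq_nonneg _
  · simpa using sq_nonneg _

/-- A side length for a box of users that is as large as possible, up to a factor, under the
constraints that it fits into a box of side `h` and that `p` times it does not exceed `1`. -/
theorem exists_box_side {p : ℝ} (h0 : 0 ≤ p) (h1 : p ≤ 1) {h : ℕ} (hh : 1 ≤ h) :
    ∃ R : ℕ, 1 ≤ R ∧ R ≤ h ∧ p * R ≤ 1 ∧ 1 / (R : ℝ) ^ 2 ≤ max (1 / (h : ℝ) ^ 2) (4 * p ^ 2) := by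
  rcases le_or_gt (p * h) 1 with hp | hp
  · exact ⟨h, hh, le_rfl, hp, le_max_left _ _⟩
  · have hpos : 0 < p := by
      by_contra hn
      have : p = 0 := le_antisymm (not_lt.1 hn) h0
      rw [this] at hp; norm_num at hp
    have hfl : 1 ≤ ⌊1 / p⌋₊ := Nat.le_floor (by rw [Nat.cast_one]; exact one_le_one_div hpos h1)
    have hle : (⌊1 / p⌋₊ : ℝ) ≤ 1 / p := Nat.floor_le (by positivity)
    refine ⟨⌊1 / p⌋₊, hfl, ?_, ?_, le_max_of_le_right ?_⟩
    · have : (⌊1 / p⌋₊ : ℝ) ≤ h := hle.trans (by rw [div_le_iff₀ hpos]; linarith)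
      exact_mod_cast this
    · calc p * ⌊1 / p⌋₊ ≤ p * (1 / p) := mul_le_mul_of_nonneg_left hle h0
        _ = 1 := by field_simp
    · have h2 : 1 / (2 * p) ≤ (⌊1 / p⌋₊ : ℝ) := by
        have := Nat.lt_floor_add_one (1 / p)
        have h3 : (1 : ℝ) ≤ ⌊1 / p⌋₊ := by exact_mod_cast hfl
        have h4 : 1 / (2 * p) = 1 / p / 2 := by field_simp
        rw [h4]; linarith
      calc 1 / (⌊1 / p⌋₊ : ℝ) ^ 2 ≤ 1 / (1 / (2 * p)) ^ 2 := by gcongr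
        _ = 4 * p ^ 2 := by field_simp; ring

/-- The least of finitely many numbers, of which there is at least one as the `α k` sum to `1`,
is attained, and so is that of their squares. -/
theorem exists_min_eq_iInf {m : ℕ} {α : Fin m → ℝ} (hα1 : ∑ k, α k = 1) (ρ : Fin m → ℝ)
    (hρ : ∀ k, 0 ≤ ρ k) :
    ∃ k₀, (∀ k, ρ k₀ ≤ ρ k) ∧ ⨅ k, ρ k = ρ k₀ ∧ ⨅ k, ρ k ^ 2 = ρ k₀ ^ 2 := by
  have : Nonempty (Fin m) := by
    by_contra h
    rw [not_nonempty_iff] at h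
    simp at hα1
  obtain ⟨k₀, hk⟩ := Finite.exists_min ρ
  refine ⟨k₀, hk, le_antisymm (ciInf_le (Set.finite_range _).bddBelow k₀) (le_ciInf hk),
    le_antisymm (ciInf_le (Set.finite_range _).bddBelow k₀) (le_ciInf fun k => ?_)⟩
  exact pow_le_pow_left₀ (hρ k₀) (hk k) 2

/-! ### The grid -/

section Grid

variable {N : ℕ}

/-- The integer coordinates of a node of the grid. -/
def gridCell (N : ℕ) (v : GridNode N) : ℤ × ℤ := (((v.1 : ℕ) : ℤ), ((v.2 : ℕ) : ℤ))

theorem gridCell_injective (N : ℕ) : Function.Injective (gridCell N) := by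
  intro v w h
  simp only [gridCell, Prod.mk.injEq, Nat.cast_inj] at h
  exact Prod.ext (Fin.ext h.1) (Fin.ext h.2)

theorem gridPos_dist_sq (v w : GridNode N) : dist (gridPos N v) (gridPos N w) ^ 2 =
    (((gridCell N v).1 - (gridCell N w).1 : ℤ) : ℝ) ^ 2 +
      (((gridCell N v).2 - (gridCell N w).2 : ℤ) : ℝ) ^ 2 := by
  rw [plane_dist_sq]
  simp [gridPos, gridCell]

theorem gridGraph_adj_iff (v w : GridNode N) :
    (gridGraph N).Adj v w ↔ taxi (gridCell N v) (gridCell N w) = 1 := by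
  have hd : dist (gridPos N v) (gridPos N w) ≤ 1 ↔
      ((gridCell N v).1 - (gridCell N w).1) ^ 2 + ((gridCell N v).2 - (gridCell N w).2) ^ 2 ≤
        (1 : ℤ) := by
    rw [← sq_le_one_iff₀ dist_nonneg, gridPos_dist_sq]
    exact_mod_cast Iff.rfl
  have hne : v ≠ w ↔ taxi (gridCell N v) (gridCell N w) ≠ 0 := by
    rw [not_iff_not]
    constructor
    · rintro rfl; exact taxi_self _
    · intro h
      apply gridCell_injective
      simp only [taxi] at h
      exact Prod.ext (by omega) (by omega)
  have hadj : (gridGraph N).Adj v w ↔ v ≠ w ∧ dist (gridPos N v) (gridPos N w) ≤ 1 := Iff.rfl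
  rw [hadj, hne, hd]
  simp only [taxi]
  generalize (gridCell N v).1 - (gridCell N w).1 = x
  generalize (gridCell N v).2 - (gridCell N w).2 = y
  constructor
  · rintro ⟨h0, h1⟩
    have hx : |x| ≤ 1 := by rw [← sq_le_one_iff_abs_le_one]; nlinarith [sq_nonneg y]
    have hy : |y| ≤ 1 := by rw [← sq_le_one_iff_abs_le_one]; nlinarith [sq_nonneg x]
    rw [abs_le] at hx hy
    obtain ⟨hx1, hx2⟩ := hx
    obtain ⟨hy1, hy2⟩ := hy
    interval_cases x <;> interval_cases y <;> simp_all
  · intro h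
    refine ⟨by omega, ?_⟩
    have : (x = 0 ∧ (y = 1 ∨ y = -1)) ∨ (y = 0 ∧ (x = 1 ∨ x = -1)) := by omega
    rcases this with ⟨rfl, rfl | rfl⟩ | ⟨rfl, rfl | rfl⟩ <;> norm_num

theorem isTaxicab_gridGraph (N : ℕ) : IsTaxicab (gridGraph N) (gridCell N) := by
  refine ⟨fun a b h => (gridGraph_adj_iff a b).1 h, ?_⟩
  rintro ⟨v1, v2⟩ ⟨w1, w2⟩ hne
  simp only [gridGraph_adj_iff]
  rcases lt_trichotomy v1 w1 with h | rfl | h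
  · refine ⟨(⟨v1 + 1, by omega⟩, v2), ?_⟩
    simp only [taxi, gridCell]; omega
  · rcases lt_trichotomy v2 w2 with h | rfl | h
    · refine ⟨(v1, ⟨v2 + 1, by omega⟩), ?_⟩
      simp only [taxi, gridCell]; omega
    · exact absurd rfl hne
    · refine ⟨(v1, ⟨v2 - 1, by omega⟩), ?_⟩
      simp only [taxi, gridCell]; omega
  · refine ⟨(⟨v1 - 1, by omega⟩, v2), ?_⟩
    simp only [taxi, gridCell]; omega

theorem gridGraph_dist (v w : GridNode N) :
    (gridGraph N).dist v w = taxi (gridCell N v) (gridCell N w) :=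
  (isTaxicab_gridGraph N).dist_eq v w

/-- Consecutive stations of a walk are adjacent. -/
theorem adj_of_infix_support {V : Type*} {G : SimpleGraph V} {v w : V} (q : G.Walk v w) {a b : V}
    (h : [b, a] <:+: q.support) : G.Adj a b := by
  have := q.isChain_adj_support.infix h
  exact (show G.Adj b a by simpa using this).symm

theorem exists_getVert_of_mem_tail {V : Type*} {G : SimpleGraph V} {v w : V} (q : G.Walk v w)
    {a : V} (h : a ∈ q.support.tail) : ∃ j, 1 ≤ j ∧ j ≤ q.length ∧ q.getVert j = a := by
  obtain ⟨i, hi, rfl⟩ := List.mem_iff_getElem.1 h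
  rw [List.length_tail, SimpleGraph.Walk.length_support] at hi
  refine ⟨i + 1, by omega, by omega, ?_⟩
  rw [List.getElem_tail, SimpleGraph.Walk.support_getElem_eq_getVert]

theorem exists_hop_of_walk {V : Type} [Fintype V] [DecidableEq V] {G : SimpleGraph V} {v s : V}
    (q : G.Walk v s) (hne : v ≠ s) :
    ∃ e ∈ Finset.univ.filter fun e : V × V => e.1 = s, [e.2, e.1] <:+: q.support := by
  refine exists_hop_of_getLast (l' := q.support.dropLast) ?_ ?_
  · conv_lhs => rw [← List.dropLast_append_getLast q.support_ne_nil]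
    simp
  · intro h
    have := congrArg List.length h
    rw [List.length_dropLast, SimpleGraph.Walk.length_support] at this
    simp at this
    exact hne this.eq

/-- Cutting a walk at its first vertex in `H`. -/
theorem uptoFirst_support {V : Type} [DecidableEq V] {G : SimpleGraph V} (H : Finset V) {v w : V}
    (p : G.Walk v w) (hw : w ∈ H) :
    ∃ (x : V) (q : G.Walk v x), uptoFirst H p.support = q.support ∧ x ∈ H ∧
      (∀ i < q.length, q.getVert i ∉ H) ∧ (∀ i ≤ q.length, q.getVert i = p.getVert i) ∧
        q.length ≤ p.length := by
  induction p with
  | nil => exact ⟨_, .nil, by simp [uptoFirst], hw, by simp, by simp, le_rfl⟩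
  | @cons a b c hadj p ih =>
    by_cases ha : a ∈ H
    · exact ⟨a, .nil, by simp [uptoFirst, ha], ha, by simp, by simp, by simp⟩
    · obtain ⟨x, q, h1, h2, h3, h4, h5⟩ := ih hw
      refine ⟨x, .cons hadj q, by simp [uptoFirst, ha, h1], h2, ?_, ?_, by simpa using h5⟩
      · intro i hi
        cases i with
        | zero => simpa using ha
        | succ i => simpa using h3 i (by simpa using hi)
      · intro i hi
        cases i with
        | zero => simp
        | succ i => simpa using h4 i (by simpa using hi)

variable {m : ℕ} {Δ W : ℝ} {α ρ : Fin m → ℝ} {D : Delivery (GridNode N) (GridNode N)}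

/-- Direct bound for deliveries along shortest paths of the grid. -/
theorem grid_mem_achievableRates (hα : ∀ k, 0 ≤ α k) (hα1 : ∑ k, α k = 1)
    (hρ : ∀ k, 0 ≤ ρ k ∧ ρ k ≤ 1) (hW : 0 < W) (hΔ : 0 < Δ)
    (hD : ∀ v S, ∃ (x : GridNode N) (q : (gridGraph N).Walk v x), D v S = q.support ∧
      q.length = (gridGraph N).dist v x) (L : ℝ)
    (hL : ∀ c k, ∑ v, eventProb (ρ k) (fun S => c ∈ (D v S).tail.map (gridCell N)) ≤ L)
    {γ : ℝ} (hγ : 0 ≤ γ) (hγL : γ * L * (⌈2 + Δ⌉₊ : ℝ) ^ 2 ≤ W) :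
    γ ∈ achievableRates (gridPos N) 1 Δ W α ρ D := by
  have hQ : 2 + Δ ≤ ⌈2 + Δ⌉₊ := Nat.le_ceil _
  refine mem_achievableRates_of_cells hα hα1 hρ hW (gridCell N) ⌈2 + Δ⌉₊
    (Nat.ceil_pos.2 (by linarith)) ?_ ?_ ?_ L hL hγ hγL
  · have key : ∀ x y : ℕ, (⌈2 + Δ⌉₊ : ℤ) ≤ |(x : ℤ) - y| → (⌈2 + Δ⌉₊ : ℝ) ≤ |(x : ℝ) - y| := by
      intro x y h
      exact_mod_cast h
    intro a b h
    rw [mul_one]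
    refine hQ.trans ?_
    rcases h with h | h
    · exact (key _ _ h).trans (abs_sub_le_plane_dist (gridPos N a) (gridPos N b) 0)
    · exact (key _ _ h).trans (abs_sub_le_plane_dist (gridPos N a) (gridPos N b) 1)
  · intro v S a b h
    obtain ⟨x, q, hq, -⟩ := hD v S
    exact adj_of_infix_support q (hq ▸ h)
  · intro v S
    obtain ⟨x, q, hq, hl⟩ := hD v S
    rw [hq]
    exact (((q.isPath_of_length_eq_dist hl).support_nodup).tail).map (gridCell_injective N)

/-- Converse bound on the grid.  The users of a box of side `R` next to the server compete for
the channel around the server. -/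
theorem grid_rate_mul_le (hα : ∀ k, 0 ≤ α k) (hρ : ∀ k, 0 ≤ ρ k ∧ ρ k ≤ 1) (hW : 0 ≤ W)
    (hΔ : 0 < Δ) {γ : ℝ} (hγ : γ ∈ achievableRates (gridPos N) 1 Δ W α ρ D) {R : ℕ}
    (hR : R ≤ N / 2) (hR1 : 1 ≤ R) (k : Fin m) {q : ℝ} (hq : ρ k ≤ q) (hq1 : q < 1) (B : ℝ)
    (T : GridNode N → Finset (GridNode N))
    (hT : ∀ v, v ≠ gridServer N → taxi (gridCell N v) (gridCell N (gridServer N)) ≤ 2 * R →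
      ρ k * (T v).card ≤ B ∧ ∀ S, Disjoint S (T v) →
        ∃ p : (gridGraph N).Walk v (gridServer N), D v S = p.support) :
    γ * (α k * ((R : ℝ) ^ 2 * Real.exp (-(B / (1 - q))))) ≤ W := by
  classical
  set I : Finset (Fin (N + 1)) := Finset.Ico ⟨N / 2 - R, by omega⟩ ⟨N / 2, by omega⟩
  have hI : I.card = R := by
    simp only [I, Fin.card_Ico]; omega
  have h := rate_mul_le hα hρ hW hγ (Finset.univ.filter fun e => e.1 = gridServer N) 1
    zero_le_one (fun A hA => card_inter_out_le_one one_pos hΔ (gridServer N) hA) (I ×ˢ I) k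
    (Real.exp (-(B / (1 - q)))) ?_
  · rw [Finset.card_product, hI, mul_one] at h
    push_cast at h
    rwa [sq]
  · intro v hv
    rw [Finset.mem_product] at hv
    simp only [I, Finset.mem_Ico, Fin.le_def, Fin.lt_def] at hv
    have hne : v ≠ gridServer N := by
      rintro rfl
      simp [gridServer] at hv
    obtain ⟨hB, hS⟩ := hT v hne (by simp only [taxi, gridCell, gridServer]; omega)
    refine exp_le_eventProb (hρ k).1 hq hq1 (T v) (fun S hd => ?_) hB
    obtain ⟨p, hp⟩ := hS S hd
    rw [hp]
    exact exists_hop_of_walk p hne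

theorem sum_eventProb_le_card {U : Type} [Fintype U] {p : ℝ} (h0 : 0 ≤ p) (h1 : p ≤ 1)
    (P : U → Finset U → Prop) : ∑ v, eventProb p (P v) ≤ Fintype.card U := by
  calc ∑ v, eventProb p (P v) ≤ ∑ _v : U, (1 : ℝ) :=
        Finset.sum_le_sum fun v _ => eventProb_le_one h0 h1 _
    _ = Fintype.card U := by simp

theorem card_gridNode : (Fintype.card (GridNode N) : ℝ) = ((N + 1) ^ 2 : ℕ) := by
  simp [sq]

theorem card_gridCell_fiber_le (c : ℤ × ℤ) :
    (Finset.card {u : GridNode N | gridCell N u = c} : ℝ) ≤ 1 := by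
  have : Finset.card {u : GridNode N | gridCell N u = c} ≤ 1 := by
    rw [Finset.card_le_one]
    intro a ha b hb
    simp only [Finset.mem_filter, Finset.mem_univ, true_and] at ha hb
    exact gridCell_injective N (ha.trans hb.symm)
  exact_mod_cast this

end Grid

/-! ### Capacity of the grid -/

theorem eventProb_eq_zero {U : Type} [Fintype U] (p : ℝ) {P : Finset U → Prop}
    (h : ∀ S, ¬ P S) : eventProb p P = 0 := by
  simp [eventProb, h]

theorem le_div_max {s E x y : ℝ} (hE : 1 ≤ E) (hx : 0 < x) (h1 : s ≤ 1 / x)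
    (h2 : 0 < y → s ≤ E / y) : s ≤ E / max x y := by
  rcases le_total y x with h | h
  · rw [max_eq_left h]
    exact h1.trans (div_le_div_of_nonneg_right hE hx.le)
  · rw [max_eq_right h]
    exact h2 (hx.trans_le h)

/-- Solving the converse bound of a box of side `R` for the rate. -/
theorem rate_le_of_box {γ a w ε R f x E : ℝ} (hγ : 0 ≤ γ) (ha : 0 < a) (hax : a ≤ x)
    (hε : 0 < ε) (hR : 0 < R) (h : γ * (x * (R ^ 2 * ε)) ≤ w) (hf : 1 / R ^ 2 ≤ E * f)
    (hw : 0 ≤ w) : γ ≤ w * E / (a * ε) * f := by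
  have h1 : γ * (a * (R ^ 2 * ε)) ≤ w := le_trans (by gcongr) h
  calc γ = γ * (a * (R ^ 2 * ε)) * (1 / R ^ 2) / (a * ε) := by field_simp
    _ ≤ w * (E * f) / (a * ε) := by
        refine div_le_div_of_nonneg_right ?_ (by positivity)
        exact mul_le_mul h1 hf (by positivity) hw
    _ = _ := by ring

section Grid

variable {N m : ℕ} {Δ W w₁ w₂ a q : ℝ} {α ρ : Fin m → ℝ} {k₀ : Fin m}

/-- The capacity of the grid is of order `max (1 / n) (p ^ 2)` if the load of each node is at most
`E / p ^ 2` and the users of a box of side `1 / p` depend on the server.  For path-wise discovery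
`p` is the probability of a copy, for expanding-ring search its square root. -/
theorem grid_capacityBetween {D : Delivery (GridNode N) (GridNode N)}
    (hα : ∀ k, a ≤ α k) (ha : 0 < a) (hα1 : ∑ k, α k = 1)
    (hρ : ∀ k, 0 ≤ ρ k ∧ ρ k ≤ 1) (hw : 0 < w₁) (hW1 : w₁ ≤ W) (hW2 : W ≤ w₂) (hΔ : 0 < Δ)
    (hN : 2 ≤ N) (hq : ρ k₀ ≤ q) (hq1 : q < 1)
    (hD : ∀ v S, ∃ (x : GridNode N) (q : (gridGraph N).Walk v x), D v S = q.support ∧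
      q.length = (gridGraph N).dist v x)
    (p E B : ℝ) (hE : 1 ≤ E) (hp0 : 0 ≤ p) (hp1 : p ≤ 1)
    (hL : 0 < p → ∀ c k,
      ∑ v, eventProb (ρ k) (fun S => c ∈ (D v S).tail.map (gridCell N)) ≤ E / p ^ 2)
    (T : ℕ → GridNode N → Finset (GridNode N))
    (hT : ∀ R : ℕ, 1 ≤ R → p * R ≤ 1 → ∀ v, v ≠ gridServer N →
      taxi (gridCell N v) (gridCell N (gridServer N)) ≤ 2 * R →
      ρ k₀ * (T R v).card ≤ B ∧ ∀ S, Disjoint S (T R v) →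
        ∃ w : (gridGraph N).Walk v (gridServer N), D v S = w.support) :
    CapacityBetween (gridPos N) 1 Δ W α ρ D
      (w₁ / (E * (⌈2 + Δ⌉₊ : ℝ) ^ 2) * max (1 / (((N + 1) ^ 2 : ℕ) : ℝ)) (p ^ 2))
      (w₂ * 16 / (a * Real.exp (-(B / (1 - q)))) * max (1 / (((N + 1) ^ 2 : ℕ) : ℝ)) (p ^ 2)) := by
  set f := max (1 / (((N + 1) ^ 2 : ℕ) : ℝ)) (p ^ 2)
  have hn : (0 : ℝ) < 1 / (((N + 1) ^ 2 : ℕ) : ℝ) := by positivity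
  have hf : 0 < f := lt_max_of_lt_left hn
  have hQ : (0 : ℝ) < ⌈2 + Δ⌉₊ := by
    exact_mod_cast Nat.ceil_pos.2 (by linarith : 0 < 2 + Δ)
  have hα0 : ∀ k, 0 ≤ α k := fun k => ha.le.trans (hα k)
  refine capacityBetween_of_bounds ?_ fun γ hγ => ?_
  · refine grid_mem_achievableRates hα0 hα1 hρ (hw.trans_le hW1) hΔ hD (E / f) (fun c k => ?_)
      (by positivity) ?_
    · refine le_div_max hE hn ?_ fun hp => hL ?_ c k
      · rw [one_div_one_div, ← card_gridNode]
        exact sum_eventProb_le_card (hρ k).1 (hρ k).2 _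
      · exact lt_of_le_of_ne hp0 (by rintro rfl; norm_num at hp)
    · refine le_trans (le_of_eq ?_) hW1
      field_simp
  · obtain ⟨R, hR1, hR2, hpR, hR⟩ := exists_box_side hp0 hp1 (h := N / 2) (by omega)
    have h := grid_rate_mul_le hα0 hρ (hw.le.trans hW1) hΔ hγ hR2 hR1 k₀ hq hq1 B (T R)
      (hT R hR1 hpR)
    refine rate_le_of_box hγ.1 ha (hα k₀) (Real.exp_pos _) (by exact_mod_cast hR1)
      (h.trans hW2) (hR.trans ?_) (hw.le.trans (hW1.trans hW2))
    refine max_le ?_ ?_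
    · have h2 : ((N : ℝ) + 1) / 4 ≤ ((N / 2 : ℕ) : ℝ) := by
        have : N + 1 ≤ 4 * (N / 2) := by omega
        have : (N : ℝ) + 1 ≤ 4 * ((N / 2 : ℕ) : ℝ) := by exact_mod_cast this
        linarith
      calc 1 / ((N / 2 : ℕ) : ℝ) ^ 2 ≤ 1 / (((N : ℝ) + 1) / 4) ^ 2 := by gcongr
        _ = 16 * (1 / (((N + 1) ^ 2 : ℕ) : ℝ)) := by push_cast; field_simp; ring
        _ ≤ 16 * f := by gcongr; exact le_max_left _ _
    · have : p ^ 2 ≤ f := le_max_right _ _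
      have : 0 ≤ p ^ 2 := sq_nonneg p
      linarith

theorem exists_geodesic (v x : GridNode N) :
    ∃ p : (gridGraph N).Walk v x, p.length = (gridGraph N).dist v x := by
  rw [gridGraph_dist]
  exact (isTaxicab_gridGraph N).exists_walk v x

theorem exists_isGridPathwise (N : ℕ) : ∃ D, IsGridPathwise N D := by
  choose route hr using fun v : GridNode N => exists_geodesic v (gridServer N)
  exact ⟨fun v S => uptoFirst (insert (gridServer N) S) (route v).support, route, hr,
    fun _ _ => rfl⟩

theorem exists_isGridRingSearch (N : ℕ) : ∃ D, IsGridRingSearch N D := by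
  have h : ∀ v S, ∃ x ∈ insert (gridServer N) S,
      ∀ y ∈ insert (gridServer N) S, (gridGraph N).dist v x ≤ (gridGraph N).dist v y := fun v S =>
    Finset.exists_min_image _ _ (Finset.insert_nonempty _ _)
  choose x hx hmin using h
  choose p hp using fun v S => exists_geodesic v (x v S)
  exact ⟨fun v S => (p v S).support, fun v S => ⟨x v S, hx v S, hmin v S, p v S, hp v S, rfl⟩⟩

/-- Path-wise discovery on the grid.  A node at distance `d` from the user has to forward the
content only if the `d` nodes before it all lack it. -/
theorem gridPathwise_eventProb_le {D : Delivery (GridNode N) (GridNode N)}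
    {route : ∀ v, (gridGraph N).Walk v (gridServer N)}
    (hr : ∀ v, (route v).length = (gridGraph N).dist v (gridServer N))
    (hD : ∀ v S, D v S = uptoFirst (insert (gridServer N) S) (route v).support)
    {p : ℝ} (h0 : 0 ≤ p) (h1 : p ≤ 1) (c : ℤ × ℤ) (v : GridNode N) :
    eventProb p (fun S => c ∈ (D v S).tail.map (gridCell N)) ≤
      Real.exp (-(p * taxi (gridCell N v) c)) := by
  have hr' : (route v).length = taxi (gridCell N v) (gridCell N (gridServer N)) := by
    rw [hr, gridGraph_dist]
  have key : ∀ S, c ∈ (D v S).tail.map (gridCell N) →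
      ∃ j ≤ (route v).length, gridCell N ((route v).getVert j) = c ∧
        ∀ i < j, (route v).getVert i ∉ S := by
    intro S hc
    obtain ⟨x, q, h1, -, h3, h4, h5⟩ := uptoFirst_support (insert (gridServer N) S) (route v)
      (Finset.mem_insert_self _ _)
    rw [hD, h1, List.mem_map] at hc
    obtain ⟨b, hb, rfl⟩ := hc
    obtain ⟨j, hj1, hj2, rfl⟩ := exists_getVert_of_mem_tail q hb
    refine ⟨j, hj2.trans h5, by rw [h4 j hj2], fun i hi hS => ?_⟩
    apply h3 i (by omega)
    rw [h4 i (by omega)]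
    exact Finset.mem_insert_of_mem hS
  by_cases hex : ∃ S, c ∈ (D v S).tail.map (gridCell N)
  · obtain ⟨S₀, hS₀⟩ := hex
    obtain ⟨j, hj, rfl, -⟩ := key S₀ hS₀
    have hT : ((Finset.range j).image (route v).getVert).card = j := by
      rw [Finset.card_image_of_injOn, Finset.card_range]
      intro i hi i' hi' hii
      simp only [Finset.coe_range, Set.mem_Iio] at hi hi'
      exact (isTaxicab_gridGraph N).getVert_inj hr' (by omega) (by omega) hii
    rw [((isTaxicab_gridGraph N).taxi_getVert hr' hj).1]
    refine (eventProb_le_exp h0 h1 ((Finset.range j).image (route v).getVert)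
      fun S hS => ?_).trans_eq (by rw [hT])
    obtain ⟨j', hj', hjj, hS'⟩ := key S hS
    obtain rfl : j' = j :=
      (isTaxicab_gridGraph N).getVert_inj hr' hj' hj (gridCell_injective N hjj)
    rw [Finset.disjoint_right]
    intro u hu
    obtain ⟨i, hi, rfl⟩ := Finset.mem_image.1 hu
    exact hS' i (Finset.mem_range.1 hi)
  · push Not at hex
    rw [eventProb_eq_zero _ hex]
    exact (Real.exp_pos _).le

/-- A user at distance at most `2 R` from the server depends on it if the at most `2 R + 1 ≤ 3 R`
nodes of its route lack the content. -/
theorem gridPathwise_capacityBetween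
    (hα : ∀ k, a ≤ α k) (ha : 0 < a) (hα1 : ∑ k, α k = 1)
    (hρ : ∀ k, 0 ≤ ρ k ∧ ρ k ≤ 1) (hw : 0 < w₁) (hW1 : w₁ ≤ W) (hW2 : W ≤ w₂) (hΔ : 0 < Δ)
    (hN : 2 ≤ N) (hmin : ∀ k, ρ k₀ ≤ ρ k) (hq : ρ k₀ ≤ q) (hq1 : q < 1)
    {D : Delivery (GridNode N) (GridNode N)} (hD : IsGridPathwise N D) :
    CapacityBetween (gridPos N) 1 Δ W α ρ D
      (w₁ / (32 * (⌈2 + Δ⌉₊ : ℝ) ^ 2) * max (1 / (((N + 1) ^ 2 : ℕ) : ℝ)) (ρ k₀ ^ 2))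
      (w₂ * 16 / (a * Real.exp (-(3 / (1 - q)))) *
        max (1 / (((N + 1) ^ 2 : ℕ) : ℝ)) (ρ k₀ ^ 2)) := by
  obtain ⟨route, hr, hD⟩ := hD
  refine grid_capacityBetween (k₀ := k₀) hα ha hα1 hρ hw hW1 hW2 hΔ hN hq hq1 (fun v S => ?_)
    (ρ k₀) 32 3 (by norm_num) (hρ k₀).1 (hρ k₀).2 (fun hp c k => ?_)
    (fun _ v => (route v).support.toFinset) fun R hR hpR v hv hd => ⟨?_, fun S hS => ?_⟩
  · obtain ⟨x, q, h1, -, -, h4, h5⟩ := uptoFirst_support (insert (gridServer N) S) (route v)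
      (Finset.mem_insert_self _ _)
    refine ⟨x, q, (hD v S).trans h1, ?_⟩
    have := ((isTaxicab_gridGraph N).taxi_getVert ((hr v).trans (gridGraph_dist _ _)) h5).1
    rw [← h4 _ le_rfl, SimpleGraph.Walk.getVert_length] at this
    rw [gridGraph_dist, this]
  · have hk : 0 < ρ k := hp.trans_le (hmin k)
    calc _ ≤ ∑ v, Real.exp (-(ρ k * taxi (gridCell N v) c)) :=
          Finset.sum_le_sum fun v _ => gridPathwise_eventProb_le hr hD (hρ k).1 (hρ k).2 c v
      _ ≤ 1 * (32 / ρ k ^ 2) := sum_taxi_le (gridCell N) 1 zero_le_one card_gridCell_fiber_le c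
          (fun d => Real.exp (-(ρ k * d))) (fun d => (Real.exp_pos _).le) _
          (sum_sphere_exp_le' hk (hρ k).2)
      _ ≤ 32 / ρ k₀ ^ 2 := by
          rw [one_mul]
          have := hmin k
          gcongr
  · have h1 : ((route v).support.toFinset.card : ℝ) ≤ 3 * R := by
      have := List.toFinset_card_le (route v).support
      rw [SimpleGraph.Walk.length_support, hr, gridGraph_dist] at this
      exact_mod_cast (by omega : (route v).support.toFinset.card ≤ 3 * R)
    have := mul_le_mul_of_nonneg_left h1 (hρ k₀).1
    linarith
  · obtain ⟨x, q, h1, h2, -, h4, h5⟩ := uptoFirst_support (insert (gridServer N) S) (route v)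
      (Finset.mem_insert_self _ _)
    obtain rfl : x = gridServer N := by
      refine (Finset.mem_insert.1 h2).resolve_right fun hx => ?_
      refine Finset.disjoint_left.1 hS hx ?_
      rw [List.mem_toFinset, ← SimpleGraph.Walk.getVert_length q, h4 _ le_rfl]
      exact SimpleGraph.Walk.getVert_mem_support _ _
    exact ⟨q, (hD v S).trans h1⟩

theorem card_taxi_ball_le (v : GridNode N) (e : ℕ) :
    (Finset.univ.filter fun u : GridNode N => taxi (gridCell N v) (gridCell N u) ≤ e).card ≤
      (2 * e + 1) ^ 2 := by
  calc _ ≤ (Finset.Icc ((gridCell N v).1 - e) ((gridCell N v).1 + e) ×ˢ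
        Finset.Icc ((gridCell N v).2 - e) ((gridCell N v).2 + e)).card := by
        refine Finset.card_le_card_of_injOn (gridCell N) (fun u hu => ?_)
          (gridCell_injective N).injOn
        have := (Finset.mem_filter.1 (Finset.mem_coe.1 hu)).2
        simp only [taxi] at this
        simp only [Finset.coe_product, Finset.coe_Icc, Set.mem_prod, Set.mem_Icc]
        omega
    _ = (2 * e + 1) ^ 2 := by
        rw [Finset.card_product, Int.card_Icc, Int.card_Icc, sq]
        congr 1 <;> omega

/-- Each node of the grid has, in a suitable quadrant, quadratically many nodes within a given
distance, up to the diameter of the grid. -/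
theorem sq_le_card_taxi_ball (v b : GridNode N) :
    (taxi (gridCell N v) (gridCell N b) : ℝ) ^ 2 / 16 ≤
      (Finset.univ.filter fun u : GridNode N => taxi (gridCell N v) (gridCell N u) <
        taxi (gridCell N v) (gridCell N b)).card := by
  set d := taxi (gridCell N v) (gridCell N b) with hd
  rcases Nat.eq_zero_or_pos d with h0 | hpos
  · rw [h0]; simp
  have hdN : d ≤ 2 * N := by
    rw [hd]; simp only [taxi, gridCell]; omega
  set e := (d - 1) / 4
  have hI : ∀ x : Fin (N + 1), ∃ I : Finset (Fin (N + 1)), I.card = e + 1 ∧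
      ∀ y ∈ I, (((x : ℕ) : ℤ) - ((y : ℕ) : ℤ)).natAbs ≤ e := by
    intro x
    by_cases hx : (x : ℕ) + e ≤ N
    · refine ⟨Finset.Icc x ⟨x + e, by omega⟩, ?_, fun y hy => ?_⟩
      · rw [Fin.card_Icc]; simp only; omega
      · simp only [Finset.mem_Icc, Fin.le_def] at hy
        omega
    · refine ⟨Finset.Icc ⟨x - e, by omega⟩ x, ?_, fun y hy => ?_⟩
      · rw [Fin.card_Icc]; simp only; omega
      · simp only [Finset.mem_Icc, Fin.le_def] at hy
        omega
  obtain ⟨I, hI1, hI2⟩ := hI v.1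
  obtain ⟨J, hJ1, hJ2⟩ := hI v.2
  have hle : (e + 1) * (e + 1) ≤ (Finset.univ.filter fun u : GridNode N =>
      taxi (gridCell N v) (gridCell N u) < d).card := by
    calc (e + 1) * (e + 1) = (I ×ˢ J).card := by rw [Finset.card_product, hI1, hJ1]
      _ ≤ _ := by
        refine Finset.card_le_card fun u hu => ?_
        rw [Finset.mem_product] at hu
        have h1 := hI2 _ hu.1
        have h2 := hJ2 _ hu.2
        rw [Finset.mem_filter]
        refine ⟨Finset.mem_univ _, ?_⟩
        simp only [taxi, gridCell]
        omega
  have h4 : (d : ℝ) ≤ 4 * ((e : ℝ) + 1) := by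
    exact_mod_cast (by omega : d ≤ 4 * (e + 1))
  have hle' : ((e : ℝ) + 1) * ((e : ℝ) + 1) ≤ ((Finset.univ.filter fun u : GridNode N =>
      taxi (gridCell N v) (gridCell N u) < d).card : ℝ) := by exact_mod_cast hle
  refine le_trans ?_ hle'
  have hd0 : (0 : ℝ) ≤ d := Nat.cast_nonneg d
  nlinarith

/-- Expanding-ring search on the grid.  A node at distance `d` from the user has to forward the
content only if all of the order of `d ^ 2` nodes closer to the user lack it. -/
theorem gridRingSearch_eventProb_le {D : Delivery (GridNode N) (GridNode N)}
    (hD : IsGridRingSearch N D) {p : ℝ} (h0 : 0 ≤ p) (h1 : p ≤ 1) (c : ℤ × ℤ) (v : GridNode N) :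
    eventProb p (fun S => c ∈ (D v S).tail.map (gridCell N)) ≤
      Real.exp (-(p / 16 * (taxi (gridCell N v) c : ℝ) ^ 2)) := by
  by_cases hex : ∃ S, c ∈ (D v S).tail.map (gridCell N)
  · obtain ⟨S₀, hS₀⟩ := hex
    obtain ⟨b, -, rfl⟩ := List.mem_map.1 hS₀
    refine (eventProb_le_exp h0 h1 (Finset.univ.filter fun u : GridNode N =>
      taxi (gridCell N v) (gridCell N u) < taxi (gridCell N v) (gridCell N b))
      fun S hS => ?_).trans ?_
    · obtain ⟨x, -, hmin, q, hq, hDS⟩ := hD v S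
      rw [hDS, List.mem_map] at hS
      obtain ⟨b', hb', hbb⟩ := hS
      obtain rfl := gridCell_injective N hbb
      obtain ⟨j, -, hj2, rfl⟩ := exists_getVert_of_mem_tail q hb'
      rw [gridGraph_dist] at hq
      rw [((isTaxicab_gridGraph N).taxi_getVert hq hj2).1, Finset.disjoint_right]
      intro u hu hS
      have h2 := hmin u (Finset.mem_insert_of_mem hS)
      rw [gridGraph_dist, gridGraph_dist] at h2
      have h3 := (Finset.mem_filter.1 hu).2
      omega
    · rw [Real.exp_le_exp, neg_le_neg_iff]
      calc p / 16 * (taxi (gridCell N v) (gridCell N b) : ℝ) ^ 2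
          = p * ((taxi (gridCell N v) (gridCell N b) : ℝ) ^ 2 / 16) := by ring
        _ ≤ _ := mul_le_mul_of_nonneg_left (sq_le_card_taxi_ball v b) h0
  · push Not at hex
    rw [eventProb_eq_zero _ hex]
    exact (Real.exp_pos _).le

/-- A user at distance at most `2 R` from the server depends on it if the at most
`(4 R + 1) ^ 2 ≤ 81 R ^ 2` nodes at distance at most `2 R` from the user lack the content. -/
theorem gridRingSearch_capacityBetween
    (hα : ∀ k, a ≤ α k) (ha : 0 < a) (hα1 : ∑ k, α k = 1)
    (hρ : ∀ k, 0 ≤ ρ k ∧ ρ k ≤ 1) (hw : 0 < w₁) (hW1 : w₁ ≤ W) (hW2 : W ≤ w₂) (hΔ : 0 < Δ)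
    (hN : 2 ≤ N) (hmin : ∀ k, ρ k₀ ≤ ρ k) (hq : ρ k₀ ≤ q) (hq1 : q < 1)
    {D : Delivery (GridNode N) (GridNode N)} (hD : IsGridRingSearch N D) :
    CapacityBetween (gridPos N) 1 Δ W α ρ D
      (w₁ / (384 * (⌈2 + Δ⌉₊ : ℝ) ^ 2) * max (1 / (((N + 1) ^ 2 : ℕ) : ℝ)) (ρ k₀))
      (w₂ * 16 / (a * Real.exp (-(81 / (1 - q)))) *
        max (1 / (((N + 1) ^ 2 : ℕ) : ℝ)) (ρ k₀)) := by
  have hsq : √(ρ k₀) ^ 2 = ρ k₀ := Real.sq_sqrt (hρ k₀).1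
  have h := grid_capacityBetween (D := D) (k₀ := k₀) hα ha hα1 hρ hw hW1 hW2 hΔ hN hq hq1
    (fun v S => ?_) √(ρ k₀) 384 81 (by norm_num) (Real.sqrt_nonneg _)
    (Real.sqrt_le_one.2 (hρ k₀).2) (fun hp c k => ?_)
    (fun R v => Finset.univ.filter fun u => taxi (gridCell N v) (gridCell N u) ≤ 2 * R)
    fun R hR hpR v hv hd => ⟨?_, fun S hS => ?_⟩
  · rwa [hsq] at h
  · obtain ⟨x, -, -, q, hq, hDS⟩ := hD v S
    exact ⟨x, q, hDS, hq⟩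
  · have hk : 0 < ρ k := (Real.sqrt_pos.1 hp).trans_le (hmin k)
    calc _ ≤ ∑ v, Real.exp (-(ρ k / 16 * (taxi (gridCell N v) c : ℝ) ^ 2)) :=
          Finset.sum_le_sum fun v _ => gridRingSearch_eventProb_le hD (hρ k).1 (hρ k).2 c v
      _ ≤ 1 * (24 / (ρ k / 16)) := sum_taxi_le (gridCell N) 1 zero_le_one card_gridCell_fiber_le c
          (fun d => Real.exp (-(ρ k / 16 * (d : ℝ) ^ 2))) (fun d => (Real.exp_pos _).le) _
          (sum_sphere_gauss_le (by positivity) (by linarith [(hρ k).2]))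
      _ = 384 / ρ k := by field_simp; norm_num
      _ ≤ 384 / √(ρ k₀) ^ 2 := by
          rw [hsq]
          have := hmin k
          have := Real.sqrt_pos.1 hp
          gcongr
  · have h1 := card_taxi_ball_le v (2 * R)
    have h2 : (2 * (2 * R) + 1) ^ 2 ≤ 81 * R ^ 2 := by nlinarith
    have h3 : ((Finset.univ.filter fun u : GridNode N =>
        taxi (gridCell N v) (gridCell N u) ≤ 2 * R).card : ℝ) ≤ 81 * (R : ℝ) ^ 2 := by
      exact_mod_cast h1.trans h2
    calc _ ≤ ρ k₀ * (81 * (R : ℝ) ^ 2) := mul_le_mul_of_nonneg_left h3 (hρ k₀).1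
      _ = 81 * (√(ρ k₀) * R) ^ 2 := by rw [mul_pow, hsq]; ring
      _ ≤ 81 * 1 := by
          gcongr
          exact pow_le_one₀ (by positivity) hpR
      _ = 81 := mul_one _
  · obtain ⟨x, hx, hmin, q, hq, hDS⟩ := hD v S
    obtain rfl : x = gridServer N := by
      refine (Finset.mem_insert.1 hx).resolve_right fun hxS => ?_
      refine Finset.disjoint_left.1 hS hxS (Finset.mem_filter.2 ⟨Finset.mem_univ _, ?_⟩)
      have := hmin _ (Finset.mem_insert_self _ _)
      rw [gridGraph_dist, gridGraph_dist] at this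
      exact this.trans hd
    exact ⟨q, hDS⟩

end Grid

/-! ### Cells of the unit square -/

section Cells

theorem isTaxicab_cellGraph : IsTaxicab cellGraph id := by
  have hadj : ∀ c d : ℤ × ℤ, cellGraph.Adj c d ↔ taxi c d = 1 := by
    intro c d
    have : cellGraph.Adj c d ↔ |c.1 - d.1| + |c.2 - d.2| = 1 := Iff.rfl
    rw [this, Int.abs_eq_natAbs, Int.abs_eq_natAbs]
    simp only [taxi]
    omega
  refine ⟨fun a b h => (hadj a b).1 h, ?_⟩
  rintro ⟨v1, v2⟩ ⟨w1, w2⟩ hne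
  simp only [hadj, id]
  rcases lt_trichotomy v1 w1 with h | rfl | h
  · exact ⟨(v1 + 1, v2), by simp only [taxi]; omega⟩
  · rcases lt_trichotomy v2 w2 with h | rfl | h
    · exact ⟨(v1, v2 + 1), by simp only [taxi]; omega⟩
    · exact absurd rfl hne
    · exact ⟨(v1, v2 - 1), by simp only [taxi]; omega⟩
  · exact ⟨(v1 - 1, v2), by simp only [taxi]; omega⟩

theorem cellGraph_dist (c d : ℤ × ℤ) : cellGraph.dist c d = taxi c d :=
  isTaxicab_cellGraph.dist_eq c d

/-- The cell of the `M × M` array that contains a station. -/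
noncomputable def stationCell (M : ℕ) {n : ℕ} (x : Fin n → UnitSquare) (s : Option (Fin n)) :
    ℤ × ℤ :=
  cellOf M (stationPos x s)

/-- The cells of the `M × M` array. -/
noncomputable def cellBox (M : ℕ) : Finset (ℤ × ℤ) := Finset.Ico 0 (M : ℤ) ×ˢ Finset.Ico 0 (M : ℤ)

/-- The number of users in a cell. -/
noncomputable def occupancy (M : ℕ) {n : ℕ} (x : Fin n → UnitSquare) (c : ℤ × ℤ) : ℕ :=
  Finset.card {u : Fin n | stationCell M x (some u) = c}

variable {M n : ℕ} {x : Fin n → UnitSquare}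

theorem stationPos_mem (x : Fin n → UnitSquare) (s : Option (Fin n)) (i : Fin 2) :
    0 ≤ stationPos x s i ∧ stationPos x s i ≤ 1 := by
  cases s with
  | none => fin_cases i <;> constructor <;> simp [stationPos] <;> norm_num
  | some v =>
    fin_cases i
    · exact (x v).1.2
    · exact (x v).2.2

/-- A coordinate of a point of the square, in terms of the index of its row or column of cells. -/
theorem min_floor_bounds {t : ℝ} (h0 : 0 ≤ t) (h1 : t ≤ 1) (hM : 1 ≤ M) :
    0 ≤ min ⌊M * t⌋ ((M : ℤ) - 1) ∧ min ⌊M * t⌋ ((M : ℤ) - 1) < M ∧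
      ((min ⌊M * t⌋ ((M : ℤ) - 1) : ℤ) : ℝ) ≤ M * t ∧
      M * t ≤ ((min ⌊M * t⌋ ((M : ℤ) - 1) : ℤ) : ℝ) + 1 := by
  have hM' : (1 : ℝ) ≤ M := by exact_mod_cast hM
  have hfl : 0 ≤ ⌊M * t⌋ := Int.floor_nonneg.2 (by positivity)
  have hlt := Int.lt_floor_add_one ((M : ℝ) * t)
  have hle := Int.floor_le ((M : ℝ) * t)
  have hMt : M * t ≤ M := by nlinarith
  refine ⟨by omega, by omega, ?_, ?_⟩
  · exact le_trans (by exact_mod_cast min_le_left _ _) hle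
  · rcases min_choice ⌊M * t⌋ ((M : ℤ) - 1) with h | h <;> rw [h]
    · exact hlt.le
    · push_cast; linarith

theorem stationCell_bounds (hM : 1 ≤ M) (x : Fin n → UnitSquare) (s : Option (Fin n)) :
    (0 ≤ (stationCell M x s).1 ∧ (stationCell M x s).1 < M ∧
      ((stationCell M x s).1 : ℝ) ≤ M * stationPos x s 0 ∧
      M * stationPos x s 0 ≤ ((stationCell M x s).1 : ℝ) + 1) ∧
    (0 ≤ (stationCell M x s).2 ∧ (stationCell M x s).2 < M ∧
      ((stationCell M x s).2 : ℝ) ≤ M * stationPos x s 1 ∧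
      M * stationPos x s 1 ≤ ((stationCell M x s).2 : ℝ) + 1) :=
  ⟨min_floor_bounds (stationPos_mem x s 0).1 (stationPos_mem x s 0).2 hM,
    min_floor_bounds (stationPos_mem x s 1).1 (stationPos_mem x s 1).2 hM⟩

theorem stationCell_mem_cellBox (hM : 1 ≤ M) (x : Fin n → UnitSquare) (s : Option (Fin n)) :
    stationCell M x s ∈ cellBox M := by
  obtain ⟨⟨h1, h2, -⟩, h3, h4, -⟩ := stationCell_bounds hM x s
  simp only [cellBox, Finset.mem_product, Finset.mem_Ico]
  omega

theorem stationCell_none (hM : 2 ≤ M) (x : Fin n → UnitSquare) :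
    stationCell M x none = (((M / 2 : ℕ) : ℤ), ((M / 2 : ℕ) : ℤ)) := by
  have h : ⌊(M : ℝ) * (1 / 2)⌋ = ((M / 2 : ℕ) : ℤ) := by
    rw [mul_one_div, Int.floor_eq_iff, Int.cast_natCast]
    have h1 : 2 * (M / 2) ≤ M := by omega
    have h2 : M + 1 ≤ 2 * (M / 2) + 2 := by omega
    have h1' : 2 * ((M / 2 : ℕ) : ℝ) ≤ M := by exact_mod_cast h1
    have h2' : (M : ℝ) + 1 ≤ 2 * ((M / 2 : ℕ) : ℝ) + 2 := by exact_mod_cast h2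
    constructor <;> linarith
  have h3 : stationCell M x none =
      (min ⌊(M : ℝ) * (1 / 2)⌋ ((M : ℤ) - 1), min ⌊(M : ℝ) * (1 / 2)⌋ ((M : ℤ) - 1)) := by
    simp [stationCell, cellOf, stationPos]
  rw [h3, h]
  have : min ((M / 2 : ℕ) : ℤ) ((M : ℤ) - 1) = ((M / 2 : ℕ) : ℤ) := by omega
  rw [this]

/-- Stations in the same cell or in adjacent cells are within range. -/
theorem dist_le_of_taxi_le_one {κ r : ℝ} (hM : 1 ≤ M) (hκ5 : κ * √5 ≤ 1) (hr : 0 < r)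
    (hMr : 1 ≤ M * (κ * r)) {s t : Option (Fin n)}
    (h : taxi (stationCell M x s) (stationCell M x t) ≤ 1) :
    dist (stationPos x s) (stationPos x t) ≤ r := by
  have hM' : (0 : ℝ) < M := by exact_mod_cast hM
  obtain ⟨⟨-, -, a1, a2⟩, -, -, a3, a4⟩ := stationCell_bounds hM x s
  obtain ⟨⟨-, -, b1, b2⟩, -, -, b3, b4⟩ := stationCell_bounds hM x t
  have hd := plane_dist_sq (stationPos x s) (stationPos x t)
  set u := stationPos x s 0 - stationPos x t 0
  set w := stationPos x s 1 - stationPos x t 1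
  have key : (M * u) ^ 2 + (M * w) ^ 2 ≤ 5 := by
    have hu : M * u = M * stationPos x s 0 - M * stationPos x t 0 := by ring
    have hw : M * w = M * stationPos x s 1 - M * stationPos x t 1 := by ring
    have hsq : ∀ z B : ℝ, -B ≤ z → z ≤ B → z ^ 2 ≤ B ^ 2 := fun z B h1 h2 => by nlinarith
    have hcases : ((stationCell M x s).1 = (stationCell M x t).1 ∧
        (stationCell M x s).2 ≤ (stationCell M x t).2 + 1 ∧
        (stationCell M x t).2 ≤ (stationCell M x s).2 + 1) ∨
        ((stationCell M x s).2 = (stationCell M x t).2 ∧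
        (stationCell M x s).1 ≤ (stationCell M x t).1 + 1 ∧
        (stationCell M x t).1 ≤ (stationCell M x s).1 + 1) := by
      simp only [taxi] at h; omega
    rcases hcases with ⟨h1, h2, h3⟩ | ⟨h1, h2, h3⟩
    · have h1' : ((stationCell M x s).1 : ℝ) = (stationCell M x t).1 := by exact_mod_cast h1
      have h2' : ((stationCell M x s).2 : ℝ) ≤ (stationCell M x t).2 + 1 := by exact_mod_cast h2
      have h3' : ((stationCell M x t).2 : ℝ) ≤ (stationCell M x s).2 + 1 := by exact_mod_cast h3
      have := hsq (M * u) 1 (by linarith) (by linarith)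
      have := hsq (M * w) 2 (by linarith) (by linarith)
      linarith
    · have h1' : ((stationCell M x s).2 : ℝ) = (stationCell M x t).2 := by exact_mod_cast h1
      have h2' : ((stationCell M x s).1 : ℝ) ≤ (stationCell M x t).1 + 1 := by exact_mod_cast h2
      have h3' : ((stationCell M x t).1 : ℝ) ≤ (stationCell M x s).1 + 1 := by exact_mod_cast h3
      have := hsq (M * u) 2 (by linarith) (by linarith)
      have := hsq (M * w) 1 (by linarith) (by linarith)
      linarith
  have h5 : M * dist (stationPos x s) (stationPos x t) ≤ √5 := by
    apply Real.le_sqrt_of_sq_le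
    calc _ = (M * u) ^ 2 + (M * w) ^ 2 := by rw [mul_pow, hd]; ring
      _ ≤ 5 := key
  have h6 : √5 ≤ M * r := by
    calc √5 ≤ √5 * (M * (κ * r)) := le_mul_of_one_le_right (Real.sqrt_nonneg _) hMr
      _ = M * r * (κ * √5) := by ring
      _ ≤ M * r * 1 := by gcongr
      _ = M * r := mul_one _
  exact le_of_mul_le_mul_left (h5.trans h6) hM'

/-- Stations whose cells are far apart are far apart. -/
theorem le_dist_of_cells_far {Q : ℕ} (hM : 1 ≤ M) {s t : Option (Fin n)}
    (h : (Q : ℤ) ≤ |(stationCell M x s).1 - (stationCell M x t).1| ∨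
      (Q : ℤ) ≤ |(stationCell M x s).2 - (stationCell M x t).2|) :
    (Q : ℝ) - 1 ≤ M * dist (stationPos x s) (stationPos x t) := by
  have hM' : (0 : ℝ) < M := by exact_mod_cast hM
  obtain ⟨⟨-, -, a1, a2⟩, -, -, a3, a4⟩ := stationCell_bounds hM x s
  obtain ⟨⟨-, -, b1, b2⟩, -, -, b3, b4⟩ := stationCell_bounds hM x t
  have key : ∀ i : Fin 2, (Q : ℝ) - 1 ≤ M * |stationPos x s i - stationPos x t i| →
      (Q : ℝ) - 1 ≤ M * dist (stationPos x s) (stationPos x t) := fun i hi =>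
    hi.trans (mul_le_mul_of_nonneg_left (abs_sub_le_plane_dist _ _ i) hM'.le)
  have habs : ∀ (c d : ℤ) (y z : ℝ), (Q : ℤ) ≤ |c - d| → (c : ℝ) ≤ M * y → M * y ≤ c + 1 →
      (d : ℝ) ≤ M * z → M * z ≤ d + 1 → (Q : ℝ) - 1 ≤ M * |y - z| := by
    intro c d y z h1 h2 h3 h4 h5
    have h1' : (Q : ℝ) ≤ |(c : ℝ) - d| := by exact_mod_cast h1
    have e : (M : ℝ) * |y - z| = |M * y - M * z| := by
      rw [← mul_sub, abs_mul, abs_of_pos hM']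
    rw [e]
    rcases le_abs.1 h1' with h | h
    · exact le_trans (by linarith) (le_abs_self _)
    · exact le_trans (by linarith) (neg_le_abs _)
  rcases h with h | h
  · exact key 0 (habs _ _ _ _ h a1 a2 b1 b2)
  · exact key 1 (habs _ _ _ _ h a3 a4 b3 b4)

/-- A shortest path between cells of the square stays within the square. -/
theorem getVert_mem_cellBox {c d : ℤ × ℤ} (hc : c ∈ cellBox M) (hd : d ∈ cellBox M)
    {p : cellGraph.Walk c d} (hp : p.length = taxi c d) (i : ℕ) : p.getVert i ∈ cellBox M := by
  rcases le_total i p.length with hi | hi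
  · obtain ⟨h1, h2⟩ := isTaxicab_cellGraph.taxi_getVert hp hi
    simp only [cellBox, Finset.mem_product, Finset.mem_Ico] at hc hd ⊢
    simp only [taxi, id] at h1 h2 hp
    omega
  · rw [p.getVert_of_length_le hi]
    exact hd

end Cells

/-! ### Downloads through cells -/

section Downloads

variable {M n : ℕ} {x : Fin n → UnitSquare} {D : Delivery (Fin n) (Option (Fin n))}

theorem cons_map_range'_append {β : Type*} (f : ℕ → β) (b a : β) {J : ℕ} (hJ : 1 ≤ J) :
    b :: (List.range' 1 (J - 1)).map f ++ [a] =
      (List.range (J + 1)).map fun j => if j = 0 then b else if j < J then f j else a := by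
  obtain ⟨J, rfl⟩ := Nat.exists_eq_add_of_le' hJ
  rw [List.range_succ, List.map_append, List.range_succ_eq_map, List.map_cons, List.map_map,
    List.range'_eq_map_range, List.map_map]
  simp only [List.map_cons, List.map_nil, if_true, Nat.add_sub_cancel]
  congr 2
  · refine List.map_congr_left fun j hj => ?_
    have := List.mem_range.1 hj
    simp only [Function.comp_apply, Nat.succ_eq_add_one]
    rw [if_neg (by omega), if_pos (by omega), add_comm]
  · simp

/-- The stations of a download: `st 0` is the user, `st j` is in the `j`-th cell of the path for
`1 ≤ j ≤ J`, except that for `J = 1` the content may come from the cell of the user, and the cells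
that were asked before the `J`-th one lack the content. -/
structure CellDownload (M : ℕ) (x : Fin n → UnitSquare) (v : Fin n) (S : Finset (Fin n))
    (p : cellGraph.Walk (stationCell M x (some v)) (stationCell M x none)) (J : ℕ)
    (st : ℕ → Option (Fin n)) : Prop where
  one_le : 1 ≤ J
  le_max : J ≤ max 1 p.length
  zero : st 0 = some v
  cell : ∀ j, 1 ≤ j → j ≤ J → stationCell M x (st j) = p.getVert j ∨
    (J = 1 ∧ stationCell M x (st j) = stationCell M x (some v))
  lack : ∀ j, 1 ≤ j → j < J → ∀ u ∈ S, stationCell M x (some u) ≠ p.getVert j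
  last : st J = none ∨ ∃ u ∈ S, st J = some u

theorem IsCellPathwise.exists_download (hD : IsCellPathwise M x D) :
    ∃ path : ∀ v : Fin n, cellGraph.Walk (stationCell M x (some v)) (stationCell M x none),
      (∀ v, (path v).length = taxi (stationCell M x (some v)) (stationCell M x none)) ∧
      (∀ v, ∀ S : Finset (Fin n), v ∈ S → D v S = [some v]) ∧
      ∀ v, ∀ S : Finset (Fin n), v ∉ S → ∃ J st, CellDownload M x v S (path v) J st ∧
        D v S = (List.range (J + 1)).map st := by
  obtain ⟨path, relay, hlen, hrelay, hserve⟩ := hD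
  refine ⟨path, fun v => (hlen v).trans (cellGraph_dist _ _), fun v S hv => (hserve v S).1 hv,
    fun v S hv => ?_⟩
  obtain ⟨J, hJ, hmin, a, hha, hasked, hDS⟩ := (hserve v S).2 hv
  have hJmax : J ≤ max 1 (path v).length := by
    by_contra hlt
    refine hmin (max 1 (path v).length) (le_max_left _ _) (not_le.1 hlt) none (Or.inl rfl)
      (Or.inl ?_)
    rw [(path v).getVert_of_length_le (le_max_right _ _)]
  refine ⟨J, fun j => if j = 0 then some v else if j < J then some (relay v j) else a,
    ⟨hJ, hJmax, by simp, fun j hj1 hjJ => ?_, fun j hj1 hjJ u hu h => ?_, ?_⟩, ?_⟩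
  · simp only [if_neg (by omega : ¬ j = 0)]
    split_ifs with h
    · exact Or.inl (hrelay v j hj1 (by
        have := lt_of_lt_of_le h hJmax
        rcases lt_max_iff.1 this with h | h <;> omega))
    · obtain rfl : j = J := by omega
      rcases hasked with h | ⟨h1, h2⟩
      · exact Or.inl h
      · exact Or.inr ⟨h1, h2⟩
  · exact hmin j hj1 hjJ (some u) (Or.inr ⟨u, hu, rfl⟩) (Or.inl h)
  · simp only [if_neg (by omega : ¬ J = 0), lt_irrefl, if_false]
    exact hha
  · rw [hDS]
    exact cons_map_range'_append (fun j => some (relay v j)) (some v) a hJ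

theorem exists_isCellPathwise (hM : 1 ≤ M) (hocc : ∀ c ∈ cellBox M, occupancy M x c ≠ 0) :
    ∃ D, IsCellPathwise M x D := by
  classical
  have hex : ∀ c ∈ cellBox M, ∃ u : Fin n, stationCell M x (some u) = c := by
    intro c hc
    obtain ⟨u, hu⟩ := Finset.card_ne_zero.1 (hocc c hc)
    exact ⟨u, (Finset.mem_filter.1 hu).2⟩
  choose path hpath using fun v : Fin n =>
    isTaxicab_cellGraph.exists_walk (stationCell M x (some v)) (stationCell M x none)
  have hbox : ∀ v j, (path v).getVert j ∈ cellBox M := fun v j =>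
    getVert_mem_cellBox (stationCell_mem_cellBox hM x _) (stationCell_mem_cellBox hM x _)
      (hpath v) j
  choose relay hrelay using fun v j => hex _ (hbox v j)
  let ok : Fin n → Finset (Fin n) → ℕ → Option (Fin n) → Prop := fun v S j a =>
    (a = none ∨ ∃ u ∈ S, a = some u) ∧ (stationCell M x a = (path v).getVert j ∨
      (j = 1 ∧ stationCell M x a = stationCell M x (some v)))
  have hfind : ∀ v S, ∃ J, 1 ≤ J ∧ ∃ a, ok v S J a := fun v S =>
    ⟨max 1 (path v).length, le_max_left _ _, none, Or.inl rfl, Or.inl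
      ((path v).getVert_of_length_le (le_max_right _ _)).symm⟩
  have hJ := fun v S => Nat.find_spec (hfind v S)
  have hJmin := fun v S (j : ℕ) (hj : j < Nat.find (hfind v S)) => Nat.find_min (hfind v S) hj
  choose hJ1 a ha using hJ
  refine ⟨fun v S => if v ∈ S then [some v] else
    some v :: (List.range' 1 (Nat.find (hfind v S) - 1)).map (fun j => some (relay v j)) ++
      [a v S], path, relay, fun v => (hpath v).trans (cellGraph_dist _ _).symm,
    fun v j _ _ => hrelay v j, fun v S => ⟨fun h => if_pos h, fun h =>
      ⟨Nat.find (hfind v S), hJ1 v S, fun j hj1 hj b hb hask => ?_, a v S, (ha v S).1,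
        (ha v S).2, if_neg h⟩⟩⟩
  exact hJmin v S j hj ⟨hj1, b, hb, hask⟩

namespace CellDownload

variable {v : Fin n} {S : Finset (Fin n)} {J : ℕ} {st : ℕ → Option (Fin n)}
  {p : cellGraph.Walk (stationCell M x (some v)) (stationCell M x none)}

theorem cell_of_two_le (h : CellDownload M x v S p J st) (hJ : 2 ≤ J) {j : ℕ} (hj : j ≤ J) :
    stationCell M x (st j) = p.getVert j := by
  rcases Nat.eq_zero_or_pos j with rfl | hj0
  · rw [h.zero, p.getVert_zero]
  · exact (h.cell j hj0 hj).resolve_right fun h' => by omega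

theorem le_length_of_two_le (h : CellDownload M x v S p J st) (hJ : 2 ≤ J) : J ≤ p.length := by
  have := h.le_max
  omega

theorem ne_succ (h : CellDownload M x v S p J st)
    (hp : p.length = taxi (stationCell M x (some v)) (stationCell M x none)) (hv : v ∉ S)
    {j : ℕ} (hj : j < J) : st (j + 1) ≠ st j := by
  intro he
  by_cases hJ : 2 ≤ J
  · have hl := h.le_length_of_two_le hJ
    have h1 := h.cell_of_two_le hJ (j := j + 1) (by omega)
    rw [he, h.cell_of_two_le hJ (j := j) (by omega)] at h1
    have := isTaxicab_cellGraph.getVert_inj hp (by omega) (by omega) h1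
    omega
  · have := h.one_le
    obtain rfl : J = 1 := by omega
    obtain rfl : j = 0 := by omega
    rw [zero_add, h.zero] at he
    rcases h.last with h1 | ⟨u, hu, h1⟩
    · rw [he] at h1; exact Option.some_ne_none _ h1
    · rw [he] at h1
      exact hv (Option.some_injective _ h1 ▸ hu)

theorem taxi_succ_le (h : CellDownload M x v S p J st)
    (hp : p.length = taxi (stationCell M x (some v)) (stationCell M x none))
    {j : ℕ} (hj : j < J) : taxi (stationCell M x (st (j + 1))) (stationCell M x (st j)) ≤ 1 := by
  have hstep : ∀ i, taxi (p.getVert (i + 1)) (p.getVert i) ≤ 1 := by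
    intro i
    rcases lt_or_ge i p.length with hi | hi
    · exact (isTaxicab_cellGraph.1 _ _ (p.adj_getVert_succ hi).symm).le
    · rw [p.getVert_of_length_le hi, p.getVert_of_length_le (by omega), taxi_self]
      exact zero_le_one
  by_cases hJ : 2 ≤ J
  · rw [h.cell_of_two_le hJ (by omega), h.cell_of_two_le hJ (by omega)]
    exact hstep j
  · have := h.one_le
    obtain rfl : J = 1 := by omega
    obtain rfl : j = 0 := by omega
    rw [zero_add, h.zero]
    rcases h.cell 1 le_rfl le_rfl with h1 | ⟨-, h1⟩
    · rw [h1]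
      simpa using hstep 0
    · rw [h1, taxi_self]
      exact zero_le_one

/-- The cell of a transmitter of the download, if not within one step of the user, is the cell
of the path at the right distance, and the cells of the path in between lack the content. -/
theorem exists_of_mem_tail (h : CellDownload M x v S p J st)
    (hp : p.length = taxi (stationCell M x (some v)) (stationCell M x none)) {c : ℤ × ℤ}
    (hc : c ∈ (((List.range (J + 1)).map st).tail.map (stationCell M x)))
    (h2 : 2 ≤ taxi (stationCell M x (some v)) c) :
    taxi (stationCell M x (some v)) c ≤ p.length ∧
      ∀ j, 1 ≤ j → j < taxi (stationCell M x (some v)) c →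
        ∀ u ∈ S, stationCell M x (some u) ≠ p.getVert j := by
  have hc' : ∃ j, j < J ∧ stationCell M x (st (j + 1)) = c := by
    rw [List.range_succ_eq_map] at hc
    simpa using hc
  obtain ⟨j, hj, rfl⟩ := hc'
  have hJ : 2 ≤ J := by
    by_contra hJ
    have := h.one_le
    obtain rfl : J = 1 := by omega
    obtain rfl : j = 0 := by omega
    have := h.taxi_succ_le hp hj
    rw [h.zero, taxi_comm] at this
    omega
  have hl := h.le_length_of_two_le hJ
  have hd : taxi (stationCell M x (some v)) (p.getVert (j + 1)) = j + 1 :=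
    (isTaxicab_cellGraph.taxi_getVert hp (i := j + 1) (by omega)).1
  rw [h.cell_of_two_le hJ (by omega), hd]
  exact ⟨by omega, fun i hi1 hi2 => h.lack i hi1 (by omega)⟩

theorem nodup (h : CellDownload M x v S p J st)
    (hp : p.length = taxi (stationCell M x (some v)) (stationCell M x none)) :
    (((List.range (J + 1)).map st).tail.map (stationCell M x)).Nodup := by
  rw [List.range_succ_eq_map, List.map_cons, List.tail_cons, List.map_map, List.map_map]
  by_cases hJ : 2 ≤ J
  · have hl := h.le_length_of_two_le hJ
    refine List.Nodup.map_on (fun i hi j hj hij => ?_) List.nodup_range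
    rw [List.mem_range] at hi hj
    simp only [Function.comp_apply, Nat.succ_eq_add_one] at hij
    rw [h.cell_of_two_le hJ (by omega), h.cell_of_two_le hJ (by omega)] at hij
    have := isTaxicab_cellGraph.getVert_inj hp (by omega) (by omega) hij
    omega
  · have := h.one_le
    obtain rfl : J = 1 := by omega
    simp

end CellDownload

theorem exists_of_infix_map_range {β : Type*} {f : ℕ → β} {J : ℕ} {a b : β}
    (h : [b, a] <:+: (List.range (J + 1)).map f) : ∃ j < J, f j = b ∧ f (j + 1) = a := by
  obtain ⟨s, t, h⟩ := h
  have hlen := congrArg List.length h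
  simp only [List.length_append, List.length_cons, List.length_nil, List.length_map,
    List.length_range] at hlen
  have h1 : ((List.range (J + 1)).map f)[s.length]? = some b := by rw [← h]; simp
  have h2 : ((List.range (J + 1)).map f)[s.length + 1]? = some a := by rw [← h]; simp
  rw [List.getElem?_map, List.getElem?_range (by omega)] at h1 h2
  exact ⟨s.length, by omega, by simpa using h1, by simpa using h2⟩

end Downloads

/-! ### Spatial reuse in the unit square -/

/-- The receivers of simultaneously active links are at mutual distance at least `Δ r`, so at most
of the order of `1 / r ^ 2` links can be active in the unit square. -/
theorem card_concurrent_le {n : ℕ} {x : Fin n → UnitSquare} {r Δ : ℝ} (hr : 0 < r) (hr1 : r ≤ 1)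
    (hΔ : 0 < Δ) {A : Finset (Option (Fin n) × Option (Fin n))}
    (hA : Concurrent (stationPos x) r Δ A) : (A.card : ℝ) ≤ (2 / Δ + 1) ^ 2 / r ^ 2 := by
  set z : ℝ := 2 / (Δ * r)
  have hz : 0 < z := by positivity
  set K : ℕ := ⌊z⌋₊
  have hle : A.card ≤ (Finset.range (K + 1) ×ˢ Finset.range (K + 1)).card := by
    refine Finset.card_le_card_of_injOn
      (fun e => (⌊z * stationPos x e.2 0⌋₊, ⌊z * stationPos x e.2 1⌋₊)) ?_ ?_
    · intro e _
      simp only [Finset.coe_product, Finset.coe_range, Set.mem_prod, Set.mem_Iio,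
        Nat.lt_succ_iff]
      exact ⟨Nat.floor_mono (mul_le_of_le_one_right hz.le (stationPos_mem x e.2 0).2),
        Nat.floor_mono (mul_le_of_le_one_right hz.le (stationPos_mem x e.2 1).2)⟩
    · intro e he e' he' hee
      by_contra hne
      simp only [Prod.mk.injEq] at hee
      have h1 := hA.2 e he e' he' hne
      have h2 := (hA.1 e' he').2
      have h3 := dist_triangle (stationPos x e'.1) (stationPos x e'.2) (stationPos x e.2)
      have h4 : Δ * r ≤ dist (stationPos x e'.2) (stationPos x e.2) := by linarith
      have key : ∀ i : Fin 2, ⌊z * stationPos x e.2 i⌋₊ = ⌊z * stationPos x e'.2 i⌋₊ →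
          (z * (stationPos x e'.2 i - stationPos x e.2 i)) ^ 2 ≤ 1 := by
        intro i hi
        have a1 := Nat.floor_le (mul_nonneg hz.le (stationPos_mem x e.2 i).1)
        have a2 := Nat.lt_floor_add_one (z * stationPos x e.2 i)
        have b1 := Nat.floor_le (mul_nonneg hz.le (stationPos_mem x e'.2 i).1)
        have b2 := Nat.lt_floor_add_one (z * stationPos x e'.2 i)
        rw [← hi] at b1 b2
        rw [mul_sub, sq_le_one_iff_abs_le_one, abs_le]
        constructor <;> linarith
      have h5 : (z * (Δ * r)) ^ 2 ≤ 2 := by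
        calc (z * (Δ * r)) ^ 2 ≤ (z * dist (stationPos x e'.2) (stationPos x e.2)) ^ 2 := by
              gcongr
          _ = (z * (stationPos x e'.2 0 - stationPos x e.2 0)) ^ 2 +
              (z * (stationPos x e'.2 1 - stationPos x e.2 1)) ^ 2 := by
              rw [mul_pow, plane_dist_sq]; ring
          _ ≤ 2 := by linarith [key 0 hee.1, key 1 hee.2]
      have h6 : z * (Δ * r) = 2 := by simp only [z]; field_simp
      rw [h6] at h5
      norm_num at h5
  rw [Finset.card_product, Finset.card_range] at hle
  have hK : (K : ℝ) + 1 ≤ (2 / Δ + 1) / r := by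
    have h1 : (K : ℝ) ≤ z := Nat.floor_le hz.le
    have h2 : (2 / Δ + 1) / r = z + 1 / r := by simp only [z]; field_simp
    have h3 := one_le_one_div hr hr1
    rw [h2]; linarith
  calc (A.card : ℝ) ≤ ((K : ℝ) + 1) * (K + 1) := by exact_mod_cast hle
    _ ≤ (2 / Δ + 1) / r * ((2 / Δ + 1) / r) := by gcongr
    _ = _ := by ring

/-! ### Capacity under regular occupancy -/

section Regular

variable {M n m : ℕ} {x : Fin n → UnitSquare} {D : Delivery (Fin n) (Option (Fin n))}
  {Δ W r κ δ η w₁ w₂ a q : ℝ} {α ρ : Fin m → ℝ} {k₀ : Fin m}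

/-- Every cell of the `M × M` array holds its fair share `n / M ^ 2` of the users, up to the
factors `δ` and `η`. -/
def RegularOccupancy (M : ℕ) (x : Fin n → UnitSquare) (δ η : ℝ) : Prop :=
  ∀ c ∈ cellBox M, δ * (n / (M : ℝ) ^ 2) ≤ occupancy M x c ∧
    (occupancy M x c : ℝ) ≤ η * (n / (M : ℝ) ^ 2)

theorem RegularOccupancy.le (hreg : RegularOccupancy M x δ η) (hM : 1 ≤ M) (hη : 0 ≤ η)
    (c : ℤ × ℤ) : (occupancy M x c : ℝ) ≤ η * (n / (M : ℝ) ^ 2) := by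
  by_cases hc : c ∈ cellBox M
  · exact (hreg c hc).2
  · have : occupancy M x c = 0 := by
      rw [occupancy, Finset.card_eq_zero, Finset.filter_eq_empty_iff]
      rintro u - rfl
      exact hc (stationCell_mem_cellBox hM x _)
    rw [this, Nat.cast_zero]
    positivity

/-- The users in the cells of a family. -/
noncomputable def usersIn (M : ℕ) (x : Fin n → UnitSquare) (F : Finset (ℤ × ℤ)) :
    Finset (Fin n) :=
  Finset.univ.filter fun u => stationCell M x (some u) ∈ F

theorem card_usersIn (F : Finset (ℤ × ℤ)) :
    (usersIn M x F).card = ∑ c ∈ F, occupancy M x c := by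
  rw [usersIn, Finset.card_eq_sum_card_fiberwise (f := fun u => stationCell M x (some u)) (t := F)]
  · refine Finset.sum_congr rfl fun c hc => ?_
    rw [occupancy, Finset.filter_filter]
    congr 1
    ext u
    simp only [Finset.mem_filter, Finset.mem_univ, true_and]
    exact ⟨fun h => h.2, fun h => ⟨h ▸ hc, h⟩⟩
  · intro u hu
    simpa using hu

theorem RegularOccupancy.card_usersIn_le (hreg : RegularOccupancy M x δ η) (hM : 1 ≤ M)
    (hη : 0 ≤ η) (F : Finset (ℤ × ℤ)) :
    ((usersIn M x F).card : ℝ) ≤ F.card * (η * (n / (M : ℝ) ^ 2)) := by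
  rw [card_usersIn, Nat.cast_sum, ← nsmul_eq_mul]
  exact Finset.sum_le_card_nsmul _ _ _ fun c _ => hreg.le hM hη c

theorem RegularOccupancy.le_card_usersIn (hreg : RegularOccupancy M x δ η) {F : Finset (ℤ × ℤ)}
    (hF : F ⊆ cellBox M) : F.card * (δ * (n / (M : ℝ) ^ 2)) ≤ ((usersIn M x F).card : ℝ) := by
  rw [card_usersIn, Nat.cast_sum, ← nsmul_eq_mul]
  exact Finset.card_nsmul_le_sum _ _ _ fun c hc => (hreg c (hF hc)).1

/-- A cell at distance `d ≥ 2` from the user transmits only if the content is missing in `d - 1`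
cells, which hold at least `(d - 1) δ n / M ^ 2` users. -/
theorem cell_eventProb_le (hreg : RegularOccupancy M x δ η) (hM : 1 ≤ M)
    {path : ∀ v : Fin n, cellGraph.Walk (stationCell M x (some v)) (stationCell M x none)}
    (hp : ∀ v, (path v).length = taxi (stationCell M x (some v)) (stationCell M x none))
    (hD1 : ∀ v, ∀ S : Finset (Fin n), v ∈ S → D v S = [some v])
    (hD2 : ∀ v, ∀ S : Finset (Fin n), v ∉ S → ∃ J st, CellDownload M x v S (path v) J st ∧
        D v S = (List.range (J + 1)).map st)
    {p : ℝ} (h0 : 0 ≤ p) (h1 : p ≤ 1) (c : ℤ × ℤ) (v : Fin n) :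
    eventProb p (fun S => c ∈ (D v S).tail.map (stationCell M x)) ≤
      Real.exp (-(p * (δ * (n / (M : ℝ) ^ 2)) *
        ((taxi (stationCell M x (some v)) c - 1 : ℕ) : ℝ))) := by
  set d := taxi (stationCell M x (some v)) c with hd
  by_cases hd2 : 2 ≤ d
  swap
  · rw [(by omega : d - 1 = 0), Nat.cast_zero, mul_zero, neg_zero, Real.exp_zero]
    exact eventProb_le_one h0 h1 _
  have key : ∀ S, c ∈ (D v S).tail.map (stationCell M x) → d ≤ (path v).length ∧
      ∀ j, 1 ≤ j → j < d → ∀ u ∈ S, stationCell M x (some u) ≠ (path v).getVert j := by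
    intro S hc
    by_cases hv : v ∈ S
    · rw [hD1 v S hv] at hc
      simp at hc
    · obtain ⟨J, st, hdl, hDS⟩ := hD2 v S hv
      rw [hDS] at hc
      exact hdl.exists_of_mem_tail (hp v) hc hd2
  by_cases hex : ∃ S, c ∈ (D v S).tail.map (stationCell M x)
  · obtain ⟨S₀, hS₀⟩ := hex
    have hdl := (key S₀ hS₀).1
    set F := (Finset.Ico 1 d).image (path v).getVert
    have hF : F.card = d - 1 := by
      rw [Finset.card_image_of_injOn, Nat.card_Ico]
      intro i hi i' hi' hii
      simp only [Finset.coe_Ico, Set.mem_Ico] at hi hi'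
      exact isTaxicab_cellGraph.getVert_inj (hp v) (by omega) (by omega) hii
    have hFbox : F ⊆ cellBox M := by
      intro c' hc'
      obtain ⟨i, -, rfl⟩ := Finset.mem_image.1 hc'
      exact getVert_mem_cellBox (stationCell_mem_cellBox hM x _)
        (stationCell_mem_cellBox hM x _) (hp v) i
    refine (eventProb_le_exp h0 h1 (usersIn M x F) fun S hS => ?_).trans ?_
    · rw [Finset.disjoint_left]
      intro u huS hu
      obtain ⟨i, hi, hiu⟩ := Finset.mem_image.1 (Finset.mem_filter.1 hu).2
      rw [Finset.mem_Ico] at hi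
      exact (key S hS).2 i hi.1 hi.2 u huS hiu.symm
    · rw [Real.exp_le_exp, neg_le_neg_iff, mul_assoc]
      refine mul_le_mul_of_nonneg_left ?_ h0
      have := hreg.le_card_usersIn hFbox
      rw [hF] at this
      linarith
  · push Not at hex
    rw [eventProb_eq_zero _ hex]
    exact (Real.exp_pos _).le

theorem le_div_min {s A B E ν p : ℝ} (hν : 0 < ν) (hp : 0 < p) (hA : 0 ≤ A) (hB : 0 ≤ B)
    (hE : A + B ≤ E) (h : s ≤ A * ν + B / (p ^ 2 * ν)) :
    s ≤ E / min (1 / ν) (p ^ 2 * ν) := by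
  have h1 : 0 < p ^ 2 * ν := by positivity
  have hmin : 0 < min (1 / ν) (p ^ 2 * ν) := lt_min (by positivity) h1
  have h2 : ν ≤ 1 / min (1 / ν) (p ^ 2 * ν) := by
    rw [le_one_div hν hmin]
    exact min_le_left _ _
  have h3 : 1 / (p ^ 2 * ν) ≤ 1 / min (1 / ν) (p ^ 2 * ν) :=
    one_div_le_one_div_of_le hmin (min_le_right _ _)
  calc s ≤ A * ν + B * (1 / (p ^ 2 * ν)) := by rw [mul_one_div]; exact h
    _ ≤ A * (1 / min (1 / ν) (p ^ 2 * ν)) + B * (1 / min (1 / ν) (p ^ 2 * ν)) := by gcongr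
    _ = (A + B) * (1 / min (1 / ν) (p ^ 2 * ν)) := by ring
    _ ≤ E * (1 / min (1 / ν) (p ^ 2 * ν)) := by gcongr
    _ = _ := by ring

/-- The number of cells that separates transmitters which may be active simultaneously. -/
noncomputable def reuseDistance (Δ κ : ℝ) : ℕ := ⌈1 + (2 + Δ) * (3 / (2 * κ))⌉₊

/-- The load of a cell: the users of nearby cells contribute one unit each, those further away
only while the content is missing. -/
theorem cell_load_le (hreg : RegularOccupancy M x δ η) (hM : 1 ≤ M) (hn : 0 < n)
    (hδ : 0 < δ) (hη : 0 < η)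
    {path : ∀ v : Fin n, cellGraph.Walk (stationCell M x (some v)) (stationCell M x none)}
    (hp : ∀ v, (path v).length = taxi (stationCell M x (some v)) (stationCell M x none))
    (hD1 : ∀ v, ∀ S : Finset (Fin n), v ∈ S → D v S = [some v])
    (hD2 : ∀ v, ∀ S : Finset (Fin n), v ∉ S → ∃ J st, CellDownload M x v S (path v) J st ∧
        D v S = (List.range (J + 1)).map st)
    {p : ℝ} (h0 : 0 < p) (h1 : p ≤ 1) (c : ℤ × ℤ) :
    ∑ v, eventProb p (fun S => c ∈ (D v S).tail.map (stationCell M x)) ≤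
      16 * η * (n / (M : ℝ) ^ 2) + 16 * η / δ ^ 2 / (p ^ 2 * (n / (M : ℝ) ^ 2)) := by
  have hn' : (0 : ℝ) < n := by exact_mod_cast hn
  have hM' : (0 : ℝ) < M := by exact_mod_cast hM
  set μ := (n : ℝ) / (M : ℝ) ^ 2
  have hμ : 0 < μ := by positivity
  set y := p * (δ * μ)
  have hy : 0 < y := by positivity
  calc _ ≤ ∑ v : Fin n, Real.exp (-(y * ((taxi (stationCell M x (some v)) c - 1 : ℕ) : ℝ))) :=
        Finset.sum_le_sum fun v _ => cell_eventProb_le hreg hM hp hD1 hD2 h0.le h1 c v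
    _ ≤ η * μ * (8 * (1 + 1 / y) ^ 2) :=
        sum_taxi_le (fun v : Fin n => stationCell M x (some v)) (η * μ) (by positivity)
          (hreg.le hM hη.le) c (fun d => Real.exp (-(y * ((d - 1 : ℕ) : ℝ))))
          (fun d => (Real.exp_pos _).le) _ (sum_sphere_exp_le hy)
    _ ≤ η * μ * (8 * (2 + 2 * (1 / y) ^ 2)) := by
        gcongr
        nlinarith [sq_nonneg (1 - 1 / y)]
    _ = _ := by simp only [y]; field_simp; ring

/-- Direct bound in the unit square. -/
theorem cell_mem_achievableRates (hα : ∀ k, 0 ≤ α k) (hα1 : ∑ k, α k = 1)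
    (hρ : ∀ k, 0 ≤ ρ k ∧ ρ k ≤ 1) (hW : 0 < W) (hΔ : 0 < Δ) (hκ : 0 < κ) (hκ5 : κ * √5 ≤ 1)
    (hr : 0 < r) (hM : 1 ≤ M) (hMr1 : 1 ≤ M * (κ * r)) (hMr2 : M * (κ * r) ≤ 3 / 2)
    {path : ∀ v : Fin n, cellGraph.Walk (stationCell M x (some v)) (stationCell M x none)}
    (hp : ∀ v, (path v).length = taxi (stationCell M x (some v)) (stationCell M x none))
    (hD1 : ∀ v, ∀ S : Finset (Fin n), v ∈ S → D v S = [some v])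
    (hD2 : ∀ v, ∀ S : Finset (Fin n), v ∉ S → ∃ J st, CellDownload M x v S (path v) J st ∧
        D v S = (List.range (J + 1)).map st) (L : ℝ)
    (hL : ∀ c k, ∑ v, eventProb (ρ k) (fun S => c ∈ (D v S).tail.map (stationCell M x)) ≤ L)
    {γ : ℝ} (hγ : 0 ≤ γ) (hγL : γ * L * (reuseDistance Δ κ : ℝ) ^ 2 ≤ W) :
    γ ∈ achievableRates (stationPos x) r Δ W α ρ D := by
  have hM' : (0 : ℝ) < M := by exact_mod_cast hM
  refine mem_achievableRates_of_cells hα hα1 hρ hW (stationCell M x) (reuseDistance Δ κ)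
    (Nat.ceil_pos.2 (by positivity)) (fun s t h => ?_) (fun v S s t h => ?_) (fun v S => ?_) L hL
    hγ hγL
  · have h1 := le_dist_of_cells_far hM h
    have h2 : 1 + (2 + Δ) * (3 / (2 * κ)) ≤ reuseDistance Δ κ := Nat.le_ceil _
    refine le_of_mul_le_mul_left ?_ hM'
    calc M * ((2 + Δ) * r) = (2 + Δ) * (M * (κ * r)) / κ := by field_simp
      _ ≤ (2 + Δ) * (3 / 2) / κ := by gcongr
      _ = (2 + Δ) * (3 / (2 * κ)) := by field_simp
      _ ≤ _ := by linarith
  · by_cases hv : v ∈ S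
    · rw [hD1 v S hv] at h
      have := h.length_le
      simp at this
    · obtain ⟨J, st, hdl, hDS⟩ := hD2 v S hv
      rw [hDS] at h
      obtain ⟨j, hj, rfl, rfl⟩ := exists_of_infix_map_range h
      exact ⟨hdl.ne_succ (hp v) hv hj,
        dist_le_of_taxi_le_one hM hκ5 hr hMr1 (hdl.taxi_succ_le (hp v) hj)⟩
  · by_cases hv : v ∈ S
    · rw [hD1 v S hv]
      simp
    · obtain ⟨J, st, hdl, hDS⟩ := hD2 v S hv
      rw [hDS]
      exact hdl.nodup (hp v)

/-- Converse bound by spatial reuse: every user needs at least one hop with probability bounded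
below. -/
theorem cell_rate_le_of_reuse (hα : ∀ k, a ≤ α k) (ha : 0 < a) (hρ : ∀ k, 0 ≤ ρ k ∧ ρ k ≤ 1)
    (hW : 0 ≤ W) (hW2 : W ≤ w₂) (hΔ : 0 < Δ) (hr : 0 < r) (hr1 : r ≤ 1) (hn : 0 < n)
    (hq : ρ k₀ ≤ q) (hq1 : q < 1)
    {path : ∀ v : Fin n, cellGraph.Walk (stationCell M x (some v)) (stationCell M x none)}
    (hD2 : ∀ v, ∀ S : Finset (Fin n), v ∉ S → ∃ J st, CellDownload M x v S (path v) J st ∧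
        D v S = (List.range (J + 1)).map st)
    {γ : ℝ} (hγ : γ ∈ achievableRates (stationPos x) r Δ W α ρ D) :
    γ ≤ w₂ * (2 / Δ + 1) ^ 2 / (a * Real.exp (-(1 / (1 - q)))) * (1 / (n * r ^ 2)) := by
  have hn' : (0 : ℝ) < n := by exact_mod_cast hn
  set ε := Real.exp (-(1 / (1 - q)))
  have hε : 0 < ε := Real.exp_pos _
  have h := rate_mul_le (fun k => ha.le.trans (hα k)) hρ hW hγ Finset.univ
    ((2 / Δ + 1) ^ 2 / r ^ 2) (by positivity)
    (fun A hA => by rw [Finset.inter_univ]; exact card_concurrent_le hr hr1 hΔ hA)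
    Finset.univ k₀ ε (fun v _ => exp_le_eventProb (hρ k₀).1 hq hq1 {v} (fun S hS => ?_)
      (by simpa using (hρ k₀).2))
  · rw [Finset.card_univ, Fintype.card_fin] at h
    have h2 : γ * (a * (n * ε)) ≤ w₂ * ((2 / Δ + 1) ^ 2 / r ^ 2) := by
      refine le_trans ?_ (h.trans (mul_le_mul_of_nonneg_right hW2 (by positivity)))
      have := hγ.1
      have := hα k₀
      gcongr
    calc γ = γ * (a * (n * ε)) / (a * (n * ε)) := by field_simp
      _ ≤ w₂ * ((2 / Δ + 1) ^ 2 / r ^ 2) / (a * (n * ε)) := by gcongr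
      _ = _ := by field_simp
  · obtain ⟨J, st, hdl, hDS⟩ := hD2 v S (by simpa using hS)
    have hJ := hdl.one_le
    obtain ⟨J, rfl⟩ := Nat.exists_eq_add_of_le' hJ
    refine ⟨(st 1, st 0), Finset.mem_univ _, ?_⟩
    rw [hDS, List.range_succ_eq_map, List.range_succ_eq_map]
    exact ⟨[], ((List.range J).map Nat.succ).map Nat.succ |>.map st, by simp⟩

/-- Converse bound by the users that depend on the server. -/
theorem cell_rate_le_of_server (hreg : RegularOccupancy M x δ η) (hα : ∀ k, a ≤ α k) (ha : 0 < a)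
    (hρ : ∀ k, 0 ≤ ρ k ∧ ρ k ≤ 1) (hW : 0 ≤ W) (hW2 : W ≤ w₂) (hΔ : 0 < Δ) (hr : 0 < r)
    (hn : 0 < n) (hM : 3 ≤ M) (hδ : 0 < δ) (hη : 0 < η) (hq : ρ k₀ ≤ q) (hq1 : q < 1)
    (hpμ : ρ k₀ * (n / (M : ℝ) ^ 2) ≤ 1)
    {path : ∀ v : Fin n, cellGraph.Walk (stationCell M x (some v)) (stationCell M x none)}
    (hp : ∀ v, (path v).length = taxi (stationCell M x (some v)) (stationCell M x none))
    (hD2 : ∀ v, ∀ S : Finset (Fin n), v ∉ S → ∃ J st, CellDownload M x v S (path v) J st ∧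
        D v S = (List.range (J + 1)).map st)
    {γ : ℝ} (hγ : γ ∈ achievableRates (stationPos x) r Δ W α ρ D) :
    γ ≤ w₂ * 9 / (a * (δ * Real.exp (-(2 * η / (1 - q))))) *
      max (1 / (n : ℝ)) (ρ k₀ ^ 2 * (n / (M : ℝ) ^ 2)) := by
  classical
  have hn' : (0 : ℝ) < n := by exact_mod_cast hn
  have hM' : (0 : ℝ) < M := by exact_mod_cast (by omega : 0 < M)
  set μ := (n : ℝ) / (M : ℝ) ^ 2 with hμdef
  have hμ : 0 < μ := by positivity
  set ε := Real.exp (-(2 * η / (1 - q)))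
  have hε : 0 < ε := Real.exp_pos _
  set h := M / 2 with hh
  obtain ⟨R, hR1, hR2, hpR, hR⟩ := exists_box_side (mul_nonneg (hρ k₀).1 hμ.le) hpμ
    (h := h) (by omega)
  have hR0 : (0 : ℝ) < R := by exact_mod_cast hR1
  set I : Finset ℤ := Finset.Ioc ((h : ℤ) - R) h with hIdef
  have hI : I.card = R := by
    simp only [I, Int.card_Ioc]; omega
  have hbox : I ×ˢ I ⊆ cellBox M := by
    intro c hc
    simp only [I, cellBox, Finset.mem_product, Finset.mem_Ioc, Finset.mem_Ico] at hc ⊢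
    omega
  have hV : (R : ℝ) ^ 2 * (δ * μ) ≤ (usersIn M x (I ×ˢ I)).card := by
    have := hreg.le_card_usersIn hbox
    rw [Finset.card_product, hI] at this
    push_cast at this
    rwa [← sq] at this
  have key := rate_mul_le (fun k => ha.le.trans (hα k)) hρ hW hγ
    (Finset.univ.filter fun e => e.1 = none) 1 zero_le_one
    (fun A hA => card_inter_out_le_one hr hΔ none hA) (usersIn M x (I ×ˢ I)) k₀ ε
    (fun v hv => exp_le_eventProb (hρ k₀).1 hq hq1
      (usersIn M x ((Finset.range ((path v).length + 1)).image (path v).getVert))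
      (fun S hS => ?_) ?_)
  · rw [mul_one] at key
    have h1 : γ * (α k₀ * ((R : ℝ) ^ 2 * (δ * μ * ε))) ≤ w₂ := by
      refine le_trans ?_ (key.trans hW2)
      have := hγ.1
      have := ha.le.trans (hα k₀)
      rw [← mul_assoc ((R : ℝ) ^ 2)]
      gcongr
    have h2 : 1 / (R : ℝ) ^ 2 ≤ 9 * μ * max (1 / (n : ℝ)) (ρ k₀ ^ 2 * μ) := by
      refine hR.trans (max_le ?_ ?_)
      · have h3 : (M : ℝ) / 3 ≤ h := by
          have : M ≤ 3 * h := by omega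
          have : (M : ℝ) ≤ 3 * h := by exact_mod_cast this
          linarith
        calc 1 / (h : ℝ) ^ 2 ≤ 1 / ((M : ℝ) / 3) ^ 2 := by gcongr
          _ = 9 * μ * (1 / (n : ℝ)) := by simp only [μ]; field_simp; norm_num
          _ ≤ _ := by gcongr; exact le_max_left _ _
      · calc 4 * (ρ k₀ * μ) ^ 2 ≤ 9 * (ρ k₀ * μ) ^ 2 := by gcongr; norm_num
          _ = 9 * μ * (ρ k₀ ^ 2 * μ) := by ring
          _ ≤ _ := by gcongr; exact le_max_right _ _
    refine (rate_le_of_box hγ.1 ha (hα k₀) (by positivity) hR0 h1 h2 (hW.trans hW2)).trans_eq ?_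
    field_simp
  · have hcell : ∀ j, (path v).getVert j ∈
        (Finset.range ((path v).length + 1)).image (path v).getVert := by
      intro j
      rcases le_total j (path v).length with hj | hj
      · exact Finset.mem_image_of_mem _ (Finset.mem_range.2 (by omega))
      · exact Finset.mem_image.2 ⟨(path v).length, Finset.mem_range.2 (by omega),
          (path v).getVert_length.trans ((path v).getVert_of_length_le hj).symm⟩
    have hlack : ∀ u ∈ S, ∀ j, stationCell M x (some u) ≠ (path v).getVert j := by
      intro u hu j hj
      refine Finset.disjoint_left.1 hS hu (Finset.mem_filter.2 ⟨Finset.mem_univ _, ?_⟩)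
      rw [hj]
      exact hcell j
    have hvS : v ∉ S := fun hvS => hlack v hvS 0 ((path v).getVert_zero).symm
    obtain ⟨J, st, hdl, hDS⟩ := hD2 v S hvS
    have hJ := hdl.one_le
    have hlast : st J = none := by
      refine hdl.last.resolve_right ?_
      rintro ⟨u, hu, he⟩
      rcases hdl.cell J hJ le_rfl with h1 | ⟨-, h1⟩
      · rw [he] at h1
        exact hlack u hu J h1
      · rw [he, ← (path v).getVert_zero] at h1
        exact hlack u hu 0 h1
    refine exists_hop_of_getLast (l' := (List.range J).map st) ?_ ?_
    · rw [hDS, List.range_succ, List.map_append, List.map_singleton, hlast]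
    · rw [Ne, List.map_eq_nil_iff, List.range_eq_nil]
      omega
  · have hlen : (path v).length + 1 ≤ 2 * R := by
      have hv' := (Finset.mem_filter.1 hv).2
      rw [Finset.mem_product, hIdef, Finset.mem_Ioc, Finset.mem_Ioc] at hv'
      rw [hp v, stationCell_none (by omega)]
      simp only [taxi]
      omega
    have h1 := hreg.card_usersIn_le (by omega) hη.le
      ((Finset.range ((path v).length + 1)).image (path v).getVert)
    have h2 : (((Finset.range ((path v).length + 1)).image (path v).getVert).card : ℝ) ≤
        2 * R := by
      have := (Finset.card_image_le (s := Finset.range ((path v).length + 1))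
        (f := (path v).getVert)).trans_eq (Finset.card_range _)
      exact_mod_cast this.trans hlen
    calc _ ≤ ρ k₀ * (2 * R * (η * μ)) := by
          refine mul_le_mul_of_nonneg_left (h1.trans ?_) (hρ k₀).1
          gcongr
      _ = 2 * η * (ρ k₀ * μ * R) := by ring
      _ ≤ 2 * η * 1 := by gcongr
      _ = 2 * η := mul_one _

/-- The capacity in the unit square, when the occupancy of the cells is regular.  The constants do
not depend on the number of users, their positions, or the delivery. -/
theorem exists_cell_capacity_constants (hα : ∀ k, a ≤ α k) (ha : 0 < a) (hα1 : ∑ k, α k = 1)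
    (hw : 0 < w₁) (hw12 : w₁ ≤ w₂) (hΔ : 0 < Δ) (hκ : 0 < κ) (hκ5 : κ * √5 ≤ 1) (hδ : 0 < δ)
    (hη : 0 < η) (hq1 : q < 1) :
    ∃ c C : ℝ, 0 < c ∧ 0 < C ∧ ∀ (n M : ℕ) (x : Fin n → UnitSquare) (r W : ℝ) (ρ : Fin m → ℝ)
      (k₀ : Fin m), 0 < n → 3 ≤ M → 0 < r → r ≤ 1 → 1 ≤ M * (κ * r) → M * (κ * r) ≤ 3 / 2 →
      w₁ ≤ W → W ≤ w₂ → (∀ k, 0 ≤ ρ k ∧ ρ k ≤ 1) → (∀ k, ρ k₀ ≤ ρ k) → ρ k₀ ≤ q →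
      RegularOccupancy M x δ η → ∀ D, IsCellPathwise M x D →
        CapacityBetween (stationPos x) r Δ W α ρ D
          (c * max (1 / (n : ℝ)) (min (1 / (n * r ^ 2)) (ρ k₀ ^ 2 * (n * r ^ 2))))
          (C * max (1 / (n : ℝ)) (min (1 / (n * r ^ 2)) (ρ k₀ ^ 2 * (n * r ^ 2)))) := by
  set E := 16 * η * κ ^ 2 + 36 * η / (δ ^ 2 * κ ^ 2) + 1
  have hE : 1 ≤ E := by
    have : 0 < 16 * η * κ ^ 2 + 36 * η / (δ ^ 2 * κ ^ 2) := by positivity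
    linarith
  have hQ : (0 : ℝ) < reuseDistance Δ κ := by
    exact_mod_cast Nat.ceil_pos.2 (by positivity : 0 < 1 + (2 + Δ) * (3 / (2 * κ)))
  set C₁ := w₂ * (2 / Δ + 1) ^ 2 / (a * Real.exp (-(1 / (1 - q))))
  set C₂ := w₂ * 9 / (a * (δ * Real.exp (-(2 * η / (1 - q)))))
  have hw2 : 0 < w₂ := hw.trans_le hw12
  have hC₁ : 0 < C₁ := by positivity
  have hC₂ : 0 < C₂ := by positivity
  have hκ1 : κ ≤ 1 := by
    have : (1 : ℝ) ≤ √5 := Real.one_le_sqrt.2 (by norm_num)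
    nlinarith
  refine ⟨w₁ / (E * (reuseDistance Δ κ : ℝ) ^ 2), max C₁ C₂, by positivity,
    lt_max_of_lt_left hC₁, ?_⟩
  intro n M x r W ρ k₀ hn hM hr hr1 hMr1 hMr2 hW1 hW2 hρ hmin hq hreg D hD
  obtain ⟨path, hp, hD1, hD2⟩ := hD.exists_download
  have hn' : (0 : ℝ) < n := by exact_mod_cast hn
  have hM' : (0 : ℝ) < M := by exact_mod_cast (by omega : 0 < M)
  set ν : ℝ := n * r ^ 2 with hνdef
  have hν : 0 < ν := by positivity
  set μ := (n : ℝ) / (M : ℝ) ^ 2 with hμdef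
  have hμ : 0 < μ := by positivity
  -- the mean occupancy `μ` of a cell is comparable to `ν`
  have hμν : μ * (M * (κ * r)) ^ 2 = κ ^ 2 * ν := by
    simp only [hμdef, hνdef]; field_simp
  have hμ1 : μ ≤ κ ^ 2 * ν := by
    rw [← hμν]
    exact le_mul_of_one_le_right hμ.le (one_le_pow₀ hMr1)
  have hμ2 : κ ^ 2 * ν ≤ 9 / 4 * μ := by
    rw [← hμν]
    have : (M * (κ * r)) ^ 2 ≤ (3 / 2) ^ 2 := by gcongr
    nlinarith
  set f := max (1 / (n : ℝ)) (min (1 / ν) (ρ k₀ ^ 2 * ν))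
  have hnf : 0 < 1 / (n : ℝ) := by positivity
  have hf : 0 < f := lt_max_of_lt_left hnf
  have hα0 : ∀ k, 0 ≤ α k := fun k => ha.le.trans (hα k)
  have hW0 : 0 < W := hw.trans_le hW1
  refine capacityBetween_of_bounds ?_ fun γ hγ => ?_
  · refine cell_mem_achievableRates hα0 hα1 hρ hW0 hΔ hκ hκ5 hr (by omega) hMr1 hMr2 hp hD1 hD2
      (E / f) (fun c k => ?_) (by positivity) ?_
    · refine le_div_max hE hnf ?_ fun hpos => ?_
      · rw [one_div_one_div]
        exact (sum_eventProb_le_card (hρ k).1 (hρ k).2 _).trans_eq (by rw [Fintype.card_fin])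
      · have hk0 : 0 < ρ k₀ := by
          refine lt_of_le_of_ne (hρ k₀).1 fun h => ?_
          rw [← h] at hpos
          simp at hpos
        have hk := hk0.trans_le (hmin k)
        refine le_div_min (A := 16 * η * κ ^ 2) (B := 36 * η / (δ ^ 2 * κ ^ 2)) hν hk0
          (by positivity) (by positivity) (by simp only [E]; linarith) ?_
        refine (cell_load_le hreg (by omega) hn hδ hη hp hD1 hD2 hk (hρ k).2 c).trans ?_
        refine add_le_add ?_ ?_
        · calc 16 * η * μ ≤ 16 * η * (κ ^ 2 * ν) := by gcongr
            _ = _ := by ring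
        · calc 16 * η / δ ^ 2 / (ρ k ^ 2 * μ)
              ≤ 16 * η / δ ^ 2 / (ρ k₀ ^ 2 * (4 / 9 * (κ ^ 2 * ν))) := by
                have := hmin k
                gcongr
                linarith
            _ = _ := by field_simp; norm_num
    · refine le_trans (le_of_eq ?_) hW1
      field_simp
  · have h1 : γ ≤ C₁ * (1 / ν) :=
      cell_rate_le_of_reuse hα ha hρ hW0.le hW2 hΔ hr hr1 hn hq hq1 hD2 hγ
    rcases le_or_gt (ρ k₀ * μ) 1 with hpμ | hpμ
    · have h2 : γ ≤ C₂ * max (1 / (n : ℝ)) (ρ k₀ ^ 2 * μ) :=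
        cell_rate_le_of_server hreg hα ha hρ hW0.le hW2 hΔ hr hn hM hδ hη hq hq1 hpμ hp hD2 hγ
      have hμν' : μ ≤ ν := hμ1.trans (mul_le_of_le_one_left hν.le (pow_le_one₀ hκ.le hκ1))
      have h3 : γ ≤ C₂ * max (1 / (n : ℝ)) (ρ k₀ ^ 2 * ν) := h2.trans (by gcongr)
      have hC0 : 0 ≤ max C₁ C₂ := hC₁.le.trans (le_max_left _ _)
      have h1' : γ ≤ max C₁ C₂ * (1 / ν) :=
        h1.trans (mul_le_mul_of_nonneg_right (le_max_left _ _) (by positivity))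
      have h3' : γ ≤ max C₁ C₂ * max (1 / (n : ℝ)) (ρ k₀ ^ 2 * ν) :=
        h3.trans (mul_le_mul_of_nonneg_right (le_max_right _ _) (le_max_of_le_left hnf.le))
      rw [mul_max_of_nonneg _ _ hC0] at h3'
      simp only [f]
      rw [mul_max_of_nonneg _ _ hC0, mul_min_of_nonneg _ _ hC0]
      rcases le_max_iff.1 h3' with h | h
      · exact le_max_of_le_left h
      · exact le_max_of_le_right (le_min h1' h)
    · -- copies are so frequent that the radio channel, not the server, is the bottleneck
      have h2 : 1 ≤ ρ k₀ * ν := by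
        refine hpμ.le.trans (mul_le_mul_of_nonneg_left ?_ (hρ k₀).1)
        exact hμ1.trans (mul_le_of_le_one_left hν.le (pow_le_one₀ hκ.le hκ1))
      have h3 : 1 / ν ≤ ρ k₀ ^ 2 * ν := by
        rw [div_le_iff₀ hν]
        calc (1 : ℝ) ≤ (ρ k₀ * ν) ^ 2 := one_le_pow₀ h2
          _ = _ := by ring
      calc γ ≤ C₁ * (1 / ν) := h1
        _ ≤ max C₁ C₂ * f := by
          refine mul_le_mul (le_max_left _ _) ?_ (by positivity) (hC₁.le.trans (le_max_left _ _))
          exact le_max_of_le_right (le_min le_rfl h3)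

end Regular

/-! ### Regular occupancy of uniformly random cells -/

open MeasureTheory

/-- The points of the unit interval whose row or column of cells has index `i`. -/
theorem volume_min_floor_eq {M : ℕ} (hM : 1 ≤ M) {i : ℤ} (h0 : 0 ≤ i) (hi : i < M) :
    MeasurableSet {t : unitInterval | min ⌊M * (t : ℝ)⌋ ((M : ℤ) - 1) = i} ∧
      volume {t : unitInterval | min ⌊M * (t : ℝ)⌋ ((M : ℤ) - 1) = i} =
        ENNReal.ofReal (1 / M) := by
  have hM' : (0 : ℝ) < M := by exact_mod_cast hM
  have h0' : (0 : ℝ) ≤ i := by exact_mod_cast h0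
  have hi' : (i : ℝ) + 1 ≤ M := by exact_mod_cast hi
  let s : unitInterval := ⟨i / M, by positivity, by rw [div_le_one hM']; linarith⟩
  let e : unitInterval := ⟨(i + 1) / M, by positivity, by rwa [div_le_one hM']⟩
  have hlen : (e : ℝ) - s = 1 / M := by simp only [s, e]; ring
  refine ⟨?_, le_antisymm ?_ ?_⟩
  · have hm : Measurable fun t : unitInterval => min ⌊M * (t : ℝ)⌋ ((M : ℤ) - 1) := by
      refine Measurable.min (Int.measurable_floor.comp ?_) measurable_const
      exact measurable_const.mul measurable_subtype_coe
    exact hm (measurableSet_singleton i)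
  · rw [← hlen, ← unitInterval.volume_Icc]
    refine measure_mono fun t ht => ?_
    obtain ⟨-, -, h1, h2⟩ := min_floor_bounds (M := M) t.2.1 t.2.2 hM
    have ht' : min ⌊M * (t : ℝ)⌋ ((M : ℤ) - 1) = i := ht
    rw [ht'] at h1 h2
    refine ⟨?_, ?_⟩
    · change (i : ℝ) / M ≤ t
      rw [div_le_iff₀ hM']; linarith
    · change (t : ℝ) ≤ (i + 1) / M
      rw [le_div_iff₀ hM']; linarith
  · rw [← hlen, ← unitInterval.volume_Ico]
    refine measure_mono fun t ht => ?_
    have h1 : (i : ℝ) / M ≤ t := ht.1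
    have h2 : (t : ℝ) < (i + 1) / M := ht.2
    rw [div_le_iff₀ hM'] at h1
    rw [lt_div_iff₀ hM'] at h2
    have hfl : ⌊M * (t : ℝ)⌋ = i := by
      rw [Int.floor_eq_iff]
      constructor <;> linarith
    change min ⌊M * (t : ℝ)⌋ ((M : ℤ) - 1) = i
    rw [hfl]
    omega

/-- The points of the unit square that lie in a cell. -/
def cellRegion (M : ℕ) (c : ℤ × ℤ) : Set UnitSquare := {u | cellOf M (squarePos u) = c}

theorem cellRegion_eq_prod (M : ℕ) (c : ℤ × ℤ) : cellRegion M c =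
    {t : unitInterval | min ⌊M * (t : ℝ)⌋ ((M : ℤ) - 1) = c.1} ×ˢ
      {t : unitInterval | min ⌊M * (t : ℝ)⌋ ((M : ℤ) - 1) = c.2} := by
  ext u
  exact Prod.ext_iff

theorem volume_cellRegion {M : ℕ} (hM : 1 ≤ M) {c : ℤ × ℤ} (hc : c ∈ cellBox M) :
    MeasurableSet (cellRegion M c) ∧
      (volume : Measure UnitSquare).real (cellRegion M c) = 1 / (M : ℝ) ^ 2 := by
  simp only [cellBox, Finset.mem_product, Finset.mem_Ico] at hc
  obtain ⟨h1, h2⟩ := volume_min_floor_eq hM hc.1.1 hc.1.2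
  obtain ⟨h3, h4⟩ := volume_min_floor_eq hM hc.2.1 hc.2.2
  rw [cellRegion_eq_prod]
  refine ⟨h1.prod h3, ?_⟩
  rw [Measure.real, Measure.volume_eq_prod, Measure.prod_prod, h2, h4,
    ← ENNReal.ofReal_mul (by positivity), ENNReal.toReal_ofReal (by positivity)]
  ring

theorem occupancy_eq_sum {n : ℕ} (M : ℕ) (x : Fin n → UnitSquare) (c : ℤ × ℤ) :
    (occupancy M x c : ℝ) = ∑ i, (cellRegion M c).indicator (fun _ => (1 : ℝ)) (x i) := by
  classical
  rw [occupancy, ← Finset.sum_boole]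
  refine Finset.sum_congr rfl fun i _ => ?_
  rw [Set.indicator_apply]
  exact if_congr Iff.rfl rfl rfl

/-- The moment generating function of the occupancy of a cell is at most that of a Poisson
variable with the same mean. -/
theorem mgf_occupancy_le {M : ℕ} (hM : 1 ≤ M) {c : ℤ × ℤ} (hc : c ∈ cellBox M) (n : ℕ) (t : ℝ) :
    Integrable (fun x : Fin n → UnitSquare => Real.exp (t * (occupancy M x c : ℝ))) ∧
      ProbabilityTheory.mgf (fun x : Fin n → UnitSquare => (occupancy M x c : ℝ)) volume t ≤
        Real.exp ((Real.exp t - 1) * (n / (M : ℝ) ^ 2)) := by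
  obtain ⟨hmeas, hvol⟩ := volume_cellRegion hM hc
  let g : UnitSquare → ℝ := fun u =>
    1 + (cellRegion M c).indicator (fun _ => Real.exp t - 1) u
  have hexp : ∀ x : Fin n → UnitSquare, Real.exp (t * (occupancy M x c : ℝ)) =
      ∏ i, g (x i) := by
    intro x
    rw [occupancy_eq_sum, Finset.mul_sum, Real.exp_sum]
    refine Finset.prod_congr rfl fun i _ => ?_
    simp only [g]
    by_cases h : x i ∈ cellRegion M c
    · simp [Set.indicator_of_mem h]
    · simp [Set.indicator_of_notMem h]
  have hind : Integrable ((cellRegion M c).indicator fun _ => Real.exp t - 1)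
      (volume : Measure UnitSquare) := (integrable_const _).indicator hmeas
  have hg : Integrable g (volume : Measure UnitSquare) := (integrable_const _).add hind
  have hint : ∫ u, g u = 1 + (Real.exp t - 1) * (1 / (M : ℝ) ^ 2) := by
    simp only [g]
    rw [integral_add (integrable_const _) hind, integral_indicator_const _ hmeas, hvol]
    simp
    ring
  refine ⟨?_, ?_⟩
  · simp only [hexp]
    exact Integrable.fintype_prod (μ := fun _ : Fin n => (volume : Measure UnitSquare))
      (f := fun _ => g) fun _ => hg
  · rw [ProbabilityTheory.mgf]
    simp only [hexp]
    rw [integral_fintype_prod_volume_eq_pow, hint, Fintype.card_fin]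
    have hpos : 0 ≤ 1 + (Real.exp t - 1) * (1 / (M : ℝ) ^ 2) := by
      rw [← hint]
      refine integral_nonneg fun u => ?_
      simp only [g, Pi.zero_apply]
      by_cases h : u ∈ cellRegion M c
      · rw [Set.indicator_of_mem h]
        linarith [Real.exp_pos t]
      · rw [Set.indicator_of_notMem h]
        norm_num
    calc (1 + (Real.exp t - 1) * (1 / (M : ℝ) ^ 2)) ^ n
        ≤ Real.exp ((Real.exp t - 1) * (1 / (M : ℝ) ^ 2)) ^ n :=
          pow_le_pow_left₀ hpos (by
            have := Real.add_one_le_exp ((Real.exp t - 1) * (1 / (M : ℝ) ^ 2))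
            linarith) n
      _ = _ := by rw [← Real.exp_nat_mul]; congr 1; ring

/-- Chernoff bounds and a union bound over the cells. -/
theorem volume_not_regularOccupancy_le {M : ℕ} (hM : 1 ≤ M) (n : ℕ) {t δ θ : ℝ} (ht : 0 ≤ t)
    (hθ : θ ≤ 1 - Real.exp (-t) - t * δ) (hθ1 : θ ≤ 1) :
    (volume : Measure (Fin n → UnitSquare)).real {x | ¬ RegularOccupancy M x δ 4} ≤
      2 * (M : ℝ) ^ 2 * Real.exp (-(θ * (n / (M : ℝ) ^ 2))) := by
  set μ := (n : ℝ) / (M : ℝ) ^ 2 with hμ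
  have hμ0 : 0 ≤ μ := by positivity
  have hcell : ∀ c ∈ cellBox M, (volume : Measure (Fin n → UnitSquare)).real
      ({x | (occupancy M x c : ℝ) ≤ δ * μ} ∪ {x | 4 * μ ≤ (occupancy M x c : ℝ)}) ≤
      2 * Real.exp (-(θ * μ)) := by
    intro c hc
    refine (measureReal_union_le _ _).trans ?_
    have hlow := ProbabilityTheory.measure_le_le_exp_mul_mgf (δ * μ) (neg_nonpos.2 ht)
      (mgf_occupancy_le hM hc n (-t)).1
    have hup := ProbabilityTheory.measure_ge_le_exp_mul_mgf (4 * μ) zero_le_one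
      (mgf_occupancy_le hM hc n 1).1
    have hlow' : Real.exp (-(-t) * (δ * μ)) *
        Real.exp ((Real.exp (-t) - 1) * μ) ≤ Real.exp (-(θ * μ)) := by
      rw [← Real.exp_add, Real.exp_le_exp]
      have := mul_le_mul_of_nonneg_right hθ hμ0
      linarith
    have hup' : Real.exp (-1 * (4 * μ)) * Real.exp ((Real.exp 1 - 1) * μ) ≤
        Real.exp (-(θ * μ)) := by
      rw [← Real.exp_add, Real.exp_le_exp]
      have h1 : Real.exp 1 ≤ 3 := Real.exp_one_lt_three.le
      have h2 := mul_le_mul_of_nonneg_right h1 hμ0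
      have h3 := mul_le_mul_of_nonneg_right hθ1 hμ0
      linarith
    have h1 := hlow.trans ((mul_le_mul_of_nonneg_left (mgf_occupancy_le hM hc n (-t)).2
      (Real.exp_pos _).le).trans hlow')
    have h2 := hup.trans ((mul_le_mul_of_nonneg_left (mgf_occupancy_le hM hc n 1).2
      (Real.exp_pos _).le).trans hup')
    linarith
  calc (volume : Measure (Fin n → UnitSquare)).real {x | ¬ RegularOccupancy M x δ 4}
      ≤ (volume : Measure (Fin n → UnitSquare)).real (⋃ c ∈ cellBox M,
        ({x | (occupancy M x c : ℝ) ≤ δ * μ} ∪ {x | 4 * μ ≤ (occupancy M x c : ℝ)})) := by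
        refine measureReal_mono (fun x hx => ?_) (measure_ne_top _ _)
        have hx' : ¬ RegularOccupancy M x δ 4 := hx
        simp only [RegularOccupancy, not_forall, not_and_or, not_le] at hx'
        obtain ⟨c, hc, h⟩ := hx'
        refine Set.mem_biUnion (Finset.mem_coe.2 hc) ?_
        rcases h with h | h
        · exact Or.inl h.le
        · exact Or.inr h.le
    _ ≤ ∑ c ∈ cellBox M, (volume : Measure (Fin n → UnitSquare)).real
        ({x | (occupancy M x c : ℝ) ≤ δ * μ} ∪ {x | 4 * μ ≤ (occupancy M x c : ℝ)}) :=
        measureReal_biUnion_finset_le _ _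
    _ ≤ ∑ _c ∈ cellBox M, 2 * Real.exp (-(θ * μ)) := Finset.sum_le_sum hcell
    _ = _ := by
        rw [Finset.sum_const, cellBox, Finset.card_product, Int.card_Ico, nsmul_eq_mul]
        simp only [sub_zero, Int.toNat_natCast]
        push_cast
        ring

/-- The size of the cells. -/
theorem cellsPerSide_bounds {κ r : ℝ} (hκ : 0 < κ) (hκ5 : κ * √5 ≤ 1) (hr : 0 < r) (hr1 : r ≤ 1) :
    3 ≤ cellsPerSide κ r ∧ 1 ≤ cellsPerSide κ r * (κ * r) ∧
      cellsPerSide κ r * (κ * r) ≤ 1 + κ * r ∧ cellsPerSide κ r * (κ * r) ≤ 3 / 2 := by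
  have hκr : 0 < κ * r := by positivity
  have h5 : (2 : ℝ) < √5 := by
    rw [Real.lt_sqrt (by norm_num)]; norm_num
  have hκ2 : κ * 2 < 1 := by nlinarith
  have hlt : κ * r < 1 / 2 := by nlinarith
  have h2 : (cellsPerSide κ r : ℝ) < 1 / (κ * r) + 1 := Nat.ceil_lt_add_one (by positivity)
  have h1 : 1 / (κ * r) ≤ cellsPerSide κ r := Nat.le_ceil _
  have h3 : cellsPerSide κ r * (κ * r) ≤ 1 + κ * r := by
    calc _ ≤ (1 / (κ * r) + 1) * (κ * r) := by gcongr
      _ = _ := by field_simp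
  refine ⟨?_, ?_, h3, by linarith⟩
  · rw [← Nat.lt_iff_add_one_le]
    refine Nat.lt_ceil.2 ?_
    rw [lt_div_iff₀ hκr]
    push_cast
    linarith
  · calc (1 : ℝ) = 1 / (κ * r) * (κ * r) := by field_simp
      _ ≤ _ := by gcongr

/-- The mean occupancy of a cell eventually exceeds `log n` by a factor above one. -/
theorem eventually_mul_log_le_occupancy {κ K : ℝ} {r : ℕ → ℝ} (hκ : 0 < κ) (hκ5 : κ * √5 ≤ 1)
    (hκK : 1 < κ * K) (hr : ∀ n, 0 < r n ∧ r n ≤ 1)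
    (hrK : ∀ᶠ n : ℕ in atTop, K * √(Real.log n / n) ≤ r n) :
    ∀ᶠ n : ℕ in atTop, κ * K * Real.log n ≤ n / (cellsPerSide κ (r n) : ℝ) ^ 2 := by
  set β := κ * K
  have hβ : 0 < β := by linarith
  have hs : Tendsto (fun n : ℕ => (1 + β * √(Real.log n / n)) ^ 2) atTop (𝓝 1) := by
    have h1 : Tendsto (fun n : ℕ => Real.log n / n) atTop (𝓝 0) := by
      have := (Real.tendsto_pow_log_div_mul_add_atTop 1 0 1 one_ne_zero).comp
        (tendsto_natCast_atTop_atTop (R := ℝ))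
      simpa [Function.comp_def] using this
    have h2 := ((h1.sqrt.const_mul β).const_add 1).pow 2
    simpa using h2
  filter_upwards [hrK, hs.eventually (ge_mem_nhds hκK), eventually_ge_atTop 1] with n h1 h2 hn
  obtain ⟨hr0, hr1⟩ := hr n
  obtain ⟨hM3, -, hM1, -⟩ := cellsPerSide_bounds hκ hκ5 hr0 hr1
  have hn' : (1 : ℝ) ≤ n := by exact_mod_cast hn
  have hlog : 0 ≤ Real.log n := Real.log_nonneg hn'
  have hM : (0 : ℝ) < cellsPerSide κ (r n) := by
    exact_mod_cast (by omega : 0 < cellsPerSide κ (r n))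
  set M : ℝ := (cellsPerSide κ (r n) : ℝ)
  set s := β * √(Real.log n / n) with hsdef
  have hs0 : 0 ≤ s := by positivity
  have hsr : s ≤ κ * r n := by
    calc s = κ * (K * √(Real.log n / n)) := by simp only [hsdef, β]; ring
      _ ≤ _ := by gcongr
  have hκr : 0 < κ * r n := by positivity
  -- `M ≤ (1 + κ r) / (κ r)`, which decreases with `r`
  have hMs : M * s ≤ 1 + s := by
    have h3 : M ≤ 1 / (κ * r n) + 1 := by
      have : 1 / (κ * r n) + 1 = (1 + κ * r n) / (κ * r n) := by field_simp
      rw [this, le_div_iff₀ hκr]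
      exact hM1
    calc M * s ≤ (1 / (κ * r n) + 1) * s := by gcongr
      _ = s / (κ * r n) + s := by ring
      _ ≤ 1 + s := by
        have := (div_le_one hκr).2 hsr
        linarith
  have h4 : (M * s) ^ 2 ≤ β := (pow_le_pow_left₀ (by positivity) hMs 2).trans h2
  have h5 : (M * s) ^ 2 = β * (β * Real.log n * M ^ 2 / n) := by
    rw [hsdef, mul_pow, mul_pow, Real.sq_sqrt (by positivity)]; ring
  rw [h5] at h4
  have h6 : β * Real.log n * M ^ 2 / n ≤ 1 := by
    by_contra h
    push Not at h
    nlinarith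
  rw [div_le_one (by linarith)] at h6
  rwa [le_div_iff₀ (by positivity)]

/-- With probability tending to one, all cells have a regular occupancy. -/
theorem exists_regularOccupancy {κ K : ℝ} {r : ℕ → ℝ} (hκ : 0 < κ) (hκ5 : κ * √5 ≤ 1)
    (hκK : 1 < κ * K) (hr : ∀ n, 0 < r n ∧ r n ≤ 1)
    (hrK : ∀ᶠ n : ℕ in atTop, K * √(Real.log n / n) ≤ r n) :
    ∃ δ : ℝ, 0 < δ ∧ Tendsto (fun n : ℕ => volume {x : Fin n → UnitSquare |
      ¬ RegularOccupancy (cellsPerSide κ (r n)) x δ 4}) atTop (𝓝 0) := by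
  set β := κ * K
  have hβ : 0 < β := by linarith
  -- any `θ < 1` with `θ β > 1` is the rate of a Chernoff bound for a small fraction of the mean
  set θ := (1 + 1 / β) / 2 with hθdef
  have hβ1 : 1 / β < 1 := by rw [div_lt_one hβ]; exact hκK
  have hβ0 : 0 < 1 / β := by positivity
  have hθ1 : θ < 1 := by rw [hθdef]; linarith
  have hθ0 : 0 < θ := by rw [hθdef]; linarith
  have hθβ : 1 < θ * β := by
    have : θ * β = (β + 1) / 2 := by rw [hθdef]; field_simp
    rw [this]; linarith
  set t := Real.log (2 / (1 - θ)) with htdef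
  have h1θ : 0 < 1 - θ := by linarith
  have ht : 0 < t := Real.log_pos (by rw [lt_div_iff₀ h1θ]; linarith)
  have hexp : Real.exp (-t) = (1 - θ) / 2 := by
    rw [Real.exp_neg, htdef, Real.exp_log (by positivity), inv_div]
  refine ⟨(1 - θ) / (2 * t), by positivity, ?_⟩
  have hδ : θ ≤ 1 - Real.exp (-t) - t * ((1 - θ) / (2 * t)) := by
    rw [hexp]
    have : t * ((1 - θ) / (2 * t)) = (1 - θ) / 2 := by field_simp
    rw [this]; linarith
  have hlim : Tendsto (fun n : ℕ => ENNReal.ofReal (2 * (n : ℝ) ^ (-(θ * β - 1)))) atTop (𝓝 0) := by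
    have := ((tendsto_rpow_neg_atTop (by linarith : 0 < θ * β - 1)).comp
      (tendsto_natCast_atTop_atTop (R := ℝ))).const_mul 2
    rw [mul_zero] at this
    simpa using ENNReal.tendsto_ofReal this
  refine tendsto_of_tendsto_of_tendsto_of_le_of_le' tendsto_const_nhds hlim
    (Eventually.of_forall fun n => zero_le) ?_
  have hlog : ∀ᶠ n : ℕ in atTop, 1 ≤ Real.log n :=
    (Real.tendsto_log_atTop.comp tendsto_natCast_atTop_atTop).eventually_ge_atTop 1
  filter_upwards [eventually_mul_log_le_occupancy hκ hκ5 hκK hr hrK, hlog,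
    eventually_ge_atTop 1] with n hμ hlog hn
  obtain ⟨hM3, -⟩ := cellsPerSide_bounds hκ hκ5 (hr n).1 (hr n).2
  have hn' : (0 : ℝ) < n := by exact_mod_cast hn
  have hM : (0 : ℝ) < cellsPerSide κ (r n) := by
    exact_mod_cast (by omega : 0 < cellsPerSide κ (r n))
  have hMn : (cellsPerSide κ (r n) : ℝ) ^ 2 ≤ n := by
    have h1 : 1 ≤ n / (cellsPerSide κ (r n) : ℝ) ^ 2 := by
      refine le_trans ?_ hμ
      nlinarith
    rwa [one_le_div (by positivity)] at h1
  have h := volume_not_regularOccupancy_le (M := cellsPerSide κ (r n)) (by omega) n ht.le hδ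
    hθ1.le
  rw [← ofReal_measureReal]
  refine ENNReal.ofReal_le_ofReal (h.trans ?_)
  calc 2 * (cellsPerSide κ (r n) : ℝ) ^ 2 *
        Real.exp (-(θ * (n / (cellsPerSide κ (r n) : ℝ) ^ 2)))
      ≤ 2 * n * Real.exp (-(θ * (β * Real.log n))) := by gcongr
    _ = 2 * (n : ℝ) ^ (-(θ * β - 1)) := by
        rw [Real.rpow_def_of_pos hn', mul_assoc]
        congr 1
        nth_rewrite 1 [← Real.exp_log hn']
        rw [← Real.exp_add]
        congr 1
        ring

end CacheNet

/-! ### The three scenarios -/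

theorem theorem3 {m : ℕ}
    (α : Fin m → ℝ) (hα : ∀ k, 0 < α k) (hα1 : ∑ k, α k = 1)
    (ρ : Fin m → ℕ → ℝ) (hρ : ∀ k n, 0 ≤ ρ k n ∧ ρ k n ≤ 1)
    (hρ1 : ∃ q : ℝ, q < 1 ∧ ∀ᶠ n in atTop, ⨅ k, ρ k n ≤ q)
    (W : ℕ → ℝ) (hW : ∀ n, 0 < W n) (hW1 : W =Θ[atTop] (fun _ => (1 : ℝ)))
    (Δ : ℝ) (hΔ : 0 < Δ) :
    -- Scenario i: grid, path-wise discovery, `n = (N + 1) ^ 2`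
    (∃ c C : ℝ, 0 < c ∧ 0 < C ∧ ∀ᶠ N : ℕ in atTop,
      let n : ℕ := (N + 1) ^ 2
      let f : ℝ := max (1 / (n : ℝ)) (⨅ k, ρ k n ^ 2)
      (∃ D, IsGridPathwise N D) ∧ ∀ D, IsGridPathwise N D →
        CapacityBetween (gridPos N) 1 Δ (W n) α (fun k => ρ k n) D (c * f) (C * f)) ∧
    -- Scenario ii: grid, expanding-ring search, `n = (N + 1) ^ 2`
    (∃ c C : ℝ, 0 < c ∧ 0 < C ∧ ∀ᶠ N : ℕ in atTop,
      let n : ℕ := (N + 1) ^ 2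
      let f : ℝ := max (1 / (n : ℝ)) (⨅ k, ρ k n)
      (∃ D, IsGridRingSearch N D) ∧ ∀ D, IsGridRingSearch N D →
        CapacityBetween (gridPos N) 1 Δ (W n) α (fun k => ρ k n) D (c * f) (C * f)) ∧
    -- Scenario iii: random network, path-wise discovery through cells of side about `κ r(n)`
    (∀ (κ K : ℝ) (r : ℕ → ℝ), 0 < κ → κ * √5 ≤ 1 → 1 < κ * K →
      (∀ n, 0 < r n ∧ r n ≤ 1) →
      (∀ᶠ n : ℕ in atTop, K * √(Real.log n / n) ≤ r n) →
      ∃ c C : ℝ, 0 < c ∧ 0 < C ∧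
        Tendsto (fun n : ℕ => MeasureTheory.volume {x : Fin n → UnitSquare |
          let M : ℕ := cellsPerSide κ (r n)
          let f : ℝ := max (1 / (n : ℝ))
            (min (1 / (n * r n ^ 2)) ((⨅ k, ρ k n ^ 2) * (n * r n ^ 2)))
          ¬ ((∃ D, IsCellPathwise M x D) ∧ ∀ D, IsCellPathwise M x D →
            CapacityBetween (stationPos x) (r n) Δ (W n) α (fun k => ρ k n) D
              (c * f) (C * f))}) atTop (𝓝 0)) := by
  obtain ⟨q, hq1, hq⟩ := hρ1
  have hmin := fun n => exists_min_eq_iInf hα1 (fun k => ρ k n) fun k => (hρ k n).1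
  obtain ⟨k₁, hk₁, -⟩ := exists_min_eq_iInf hα1 α fun k => (hα k).le
  have ha := hα k₁
  obtain ⟨w₁, hw₁, hWlow⟩ := hW1.2.exists_pos
  obtain ⟨w₂, hw₂, hWup⟩ := hW1.1.exists_pos
  have hWb : ∀ᶠ n in atTop, w₁⁻¹ ≤ W n ∧ W n ≤ w₂ := by
    filter_upwards [hWlow.bound, hWup.bound] with n h1 h2
    rw [norm_one, Real.norm_of_nonneg (hW n).le] at h1 h2
    refine ⟨?_, by linarith⟩
    rw [inv_le_iff_one_le_mul₀ hw₁]
    linarith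
  have hw₁' : 0 < w₁⁻¹ := inv_pos.2 hw₁
  have hsq : Tendsto (fun N : ℕ => (N + 1) ^ 2) atTop atTop :=
    (tendsto_pow_atTop two_ne_zero).comp (tendsto_add_atTop_nat 1)
  have hQ : (0 : ℝ) < ⌈2 + Δ⌉₊ := by
    exact_mod_cast Nat.ceil_pos.2 (by linarith : 0 < 2 + Δ)
  refine ⟨⟨w₁⁻¹ / (32 * (⌈2 + Δ⌉₊ : ℝ) ^ 2), w₂ * 16 / (α k₁ * Real.exp (-(3 / (1 - q)))),
    by positivity, by positivity, ?_⟩, ⟨w₁⁻¹ / (384 * (⌈2 + Δ⌉₊ : ℝ) ^ 2),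
    w₂ * 16 / (α k₁ * Real.exp (-(81 / (1 - q)))), by positivity, by positivity, ?_⟩, ?_⟩
  · filter_upwards [hsq.eventually hWb, hsq.eventually hq, eventually_ge_atTop 2] with N hN hqN h2
    refine ⟨exists_isGridPathwise N, fun D hD => ?_⟩
    obtain ⟨k₀, hk₀, hinf, hinf2⟩ := hmin ((N + 1) ^ 2)
    rw [hinf] at hqN
    rw [hinf2]
    exact gridPathwise_capacityBetween hk₁ ha hα1 (fun k => hρ k _) hw₁' hN.1 hN.2 hΔ h2 hk₀ hqN
      hq1 hD
  · filter_upwards [hsq.eventually hWb, hsq.eventually hq, eventually_ge_atTop 2] with N hN hqN h2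
    refine ⟨exists_isGridRingSearch N, fun D hD => ?_⟩
    obtain ⟨k₀, hk₀, hinf, hinf2⟩ := hmin ((N + 1) ^ 2)
    rw [hinf] at hqN
    rw [hinf]
    exact gridRingSearch_capacityBetween hk₁ ha hα1 (fun k => hρ k _) hw₁' hN.1 hN.2 hΔ h2 hk₀
      hqN hq1 hD
  · intro κ K r hκ hκ5 hκK hr hrK
    obtain ⟨δ, hδ, hreg⟩ := exists_regularOccupancy hκ hκ5 hκK hr hrK
    obtain ⟨n₀, hn₀⟩ := hWb.exists
    obtain ⟨c, C, hc, hC, hcap⟩ := exists_cell_capacity_constants (Δ := Δ) (κ := κ) (δ := δ)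
      (η := 4) (q := q) hk₁ ha hα1 hw₁' (hn₀.1.trans hn₀.2) hΔ hκ hκ5 hδ (by norm_num) hq1
    refine ⟨c, C, hc, hC, ?_⟩
    refine tendsto_of_tendsto_of_tendsto_of_le_of_le' tendsto_const_nhds hreg
      (Eventually.of_forall fun n => zero_le) ?_
    filter_upwards [hWb, hq, eventually_ge_atTop 1] with n hWn hqn hn
    refine MeasureTheory.measure_mono fun x hx hocc => hx ?_
    obtain ⟨hM3, hM1, -, hM2⟩ := cellsPerSide_bounds hκ hκ5 (hr n).1 (hr n).2
    obtain ⟨k₀, hk₀, hinf, hinf2⟩ := hmin n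
    rw [hinf] at hqn
    refine ⟨exists_isCellPathwise (by omega) fun c hc h0 => ?_, fun D hD => ?_⟩
    · have hn' : (0 : ℝ) < n := by exact_mod_cast hn
      have hM : (0 : ℝ) < cellsPerSide κ (r n) := by
        exact_mod_cast (by omega : 0 < cellsPerSide κ (r n))
      have h1 := (hocc c hc).1
      rw [h0, Nat.cast_zero] at h1
      have : 0 < δ * (n / (cellsPerSide κ (r n) : ℝ) ^ 2) := by positivity
      linarith
    · rw [hinf2]
      exact hcap n _ x (r n) (W n) (fun k => ρ k n) k₀ (by omega) hM3 (hr n).1 (hr n).2 hM1 hM2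
        hWn.1 hWn.2 (fun k => hρ k n) hk₀ hqn hocc D hD
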